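/- **Theorem (DPOP regret).** Let $G=(\mathcal N,\mathcal E)$ be a finite directed network with edge costs $c_{ij}\ge 0$ and capacities $\mu^{max}_{ij}$. In slots $t=1,2,\dots$ a quantity $a_{ik}(t)\ge 0$ of packets destined to $k$ (commodity $k$) arrives at node $i$; the arrivals are bounded uniformly in $t$ and have means $\lambda_{ik}=\mathbb E[a_{ik}(t)]$. Assume that $\boldsymbol\lambda$ is strictly within the stability region: there are $\epsilon>0$ and $\mu_{ijk}\ge 0$ with $\sum_k\mu_{ijk}\le\mu^{max}_{ij}$ for all $(i,j)\in\mathcal E$ and $\sum_{j:(j,i)\in\mathcal E}\mu_{jik}+\lambda_{ik}+\epsilon\le\sum_{j:(i,j)\in\mathcal E}\mu_{ijk}$ for all $i\ne k$. *Policies.* A policy $\pi$ chooses in each slot $t\ge1$ planned transmissions $\mu_{ijk}(t)\ge 0$ with $\sum_k\mu_{ijk}(t)\le\mu_{ij}^{max}$. Actual transmissions $\tilde\mu_{ijk}(t)\ge0$ and dummy packets $d_{ijk}(t)\ge 0$ satisfy $\tilde\mu_{ijk}(t)+d_{ijk}(t)\le\mu_{ijk}(t)$ and $\sum_j\tilde\mu_{ijk}(t)\le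 Q_{ik}(t)$, where the backlogs satisfy $Q_{ik}(1)=0$, $Q_{kk}(t)=0$ and, for $i\neq k$, $Q_{ik}(t+1)=Q_{ik}(t)-\sum_j\tilde\mu_{ijk}(t)+\sum_j\tilde\mu_{jik}(t)+a_{ik}(t)\le[Q_{ik}(t)-\sum_j\mu_{ijk}(t)]^++\sum_j\mu_{jik}(t)+a_{ik}(t)$. With a terminal backlog cost $C_B$ per packet, the cost over the horizon $T$ is $$C^\pi(T)=\sum_{t=1}^T\sum_{(i,j)\in\mathcal E}\sum_k(\tilde\mu_{ijk}(t)+d_{ijk}(t))c_{ij}+C_B\sum_{i,k}Q_{ik}(T),$$ and the regret is $R^\pi(T)=\mathbb E[C^\pi(T)]-\inf_{\pi^*}\mathbb E[C^{\pi^*}(T)]$, the infimum being over all policies, including those that know the costs, the arrival rates and all future arrivals. *The DPOP policy.* Every edge is observed once in an exploration slot $t=0$, and in each slot $t\ge1$ every edge with $\mu_{ijk}(t)>0$ for some $k$ is observed. An observation of $(i,j)$ in slot $t$ has the value $c_{ij}+\eta_{ij}(t)$ with zero-mean $\sigma$-sub-Gaussian noise, $\sigma>0$. The arrivals and the noise of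 slot $t$ are jointly independent of everything that is known when the decisions of slot $t$ are taken (the arrivals, the noise and the policy's randomization of earlier slots, and its randomization in slot $t$). Let $N_{ij}(t)$ be the number and $\bar c_{ij}(t)$ the average of the observations of $(i,j)$ before slot $t$, and let $\hat c_{ij}(t)=\bar c_{ij}(t)-\sqrt{\beta\log(t/\delta)/N_{ij}(t)}$. In each slot $1\le t\le T$ the Drift Plus Optimistic Penalty policy $\pi_D$ with parameters $\beta,\delta,\nu$ chooses $\boldsymbol\mu(t)$ to maximize $\sum_{(i,j)\in\mathcal E}\sum_k\mu_{ijk}\big(Q_{ik}(t)-Q_{jk}(t)-\nu\hat c_{ij}(t)\big)$ over all $\mu_{ijk}\ge0$ with $\sum_k\mu_{ijk}\le\mu^{max}_{ij}$, breaking ties in any causal way. *Claim.* There is a finite constant $C_L\ge 0$, depending only on the network topology $(\mathcal N,\mathcal E)$ and the costs $(c_{ij})$, such that the following holds whenever $C_B\ge C_L$. If for each horizon $T$ the policy $\pi_D$ is run with $\beta>4\sigma^2$ (fixed), $\delta=T^{-2\sigma^2/\beta}$ and $\nu=\sqrt T$, then, as $T\to\infty$, $$R^{\pi_D}(T)=O(\sqrt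 T\,\log T),$$ and the policy is rate stable: $\lim_{T\to\infty}\frac1T\sum_{i,k}\mathbb E[Q^{\pi_D}_{ik}(T)]=0$. -/

import Mathlib

open MeasureTheory ProbabilityTheory Filter Topology Asymptotics

noncomputable section

namespace DPOP

variable {V : Type*} [Fintype V] [DecidableEq V] {Ω : Type*} [MeasurableSpace Ω]

/-! ### Networks

`V` is the finite set of nodes and `E` the finite set of directed edges. For an edge `e : E`,
`e.1.1` is its tail and `e.1.2` its head. Commodities are indexed by their destination `k : V`. -/

/-- Total amount leaving node `i` over its outgoing edges. -/
def outflow (E : Finset (V × V)) (f : E → ℝ) (i : V) : ℝ :=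
  ∑ e : E with e.1.1 = i, f e

/-- Total amount entering node `i` over its incoming edges. -/
def inflow (E : Finset (V × V)) (f : E → ℝ) (i : V) : ℝ :=
  ∑ e : E with e.1.2 = i, f e

/-- The set of feasible transmissions: nonnegative and within the edge capacities. -/
def feasibleSet (E : Finset (V × V)) (cap : E → ℝ) : Set (E → V → ℝ) :=
  {m | (∀ e k, 0 ≤ m e k) ∧ ∀ e, ∑ k, m e k ≤ cap e}

/-- The arrival rates lie strictly within the stability region: for some `ε > 0` there is a
feasible flow that supports all rates increased by `ε`. -/
def StrictlyStable (E : Finset (V × V)) (cap : E → ℝ) (rate : V → V → ℝ) : Prop :=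
  ∃ ε > 0, ∃ m ∈ feasibleSet E cap, ∀ i k, i ≠ k →
    inflow E (fun e => m e k) i + rate i k + ε ≤ outflow E (fun e => m e k) i

/-! ### Arrivals and observation noise -/

/-- The stochastic primitives. `a t i k` is the number of packets for destination `k` arriving at
node `i` in slot `t ≥ 1`; `η t e` is the noise in the cost observation of edge `e` in slot `t ≥ 0`
(slot `0` is the exploration slot; `a 0` plays no role). `ℱ t` is the information available when
the decisions of slot `t` are taken; it may contain internal randomization of a policy. -/
structure IsModel (E : Finset (V × V)) (P : Measure Ω)
    (ℱ : Filtration ℕ (inferInstance : MeasurableSpace Ω))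
    (a : ℕ → V → V → Ω → ℝ) (rate : V → V → ℝ) (η : ℕ → E → Ω → ℝ) (σ : NNReal) : Prop where
  /-- the arrivals of a slot are known afterwards -/
  arrival_adapted : ∀ t, 1 ≤ t → ∀ i k, Measurable[ℱ (t + 1)] (a t i k)
  /-- the arrivals are nonnegative and bounded -/
  arrival_nonneg : ∀ t, 1 ≤ t → ∀ i k ω, 0 ≤ a t i k ω
  arrival_bounded : ∃ A : ℝ, ∀ t, 1 ≤ t → ∀ i k ω, a t i k ω ≤ A
  /-- the arrival rates -/
  arrival_mean : ∀ t, 1 ≤ t → ∀ i k, ∫ ω, a t i k ω ∂P = rate i k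
  /-- the observations of a slot are known afterwards -/
  noise_adapted : ∀ t e, Measurable[ℱ (t + 1)] (η t e)
  /-- the noise is zero mean and `σ`-sub-Gaussian -/
  noise_mean : ∀ t e, ∫ ω, η t e ω ∂P = 0
  noise_subgaussian : ∀ t e, HasSubgaussianMGF (η t e) (σ ^ 2) P
  /-- independence across slots: the arrivals and the noise of slot `t` are (jointly) independent
  of everything known when the decisions of slot `t` are taken -/
  indep : ∀ t, Indep
    (MeasurableSpace.comap
      (fun ω => ((fun i k => a t i k ω, fun e => η t e ω) : (V → V → ℝ) × (E → ℝ)))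
      inferInstance) (ℱ t) P

/-! ### Policies, costs and regret -/

/-- A feasible control policy, given by the processes that it produces. Nothing but measurability
restricts how these depend on the outcome `ω`, so that policies which know the costs, the
arrival rates and all future arrivals are included. -/
structure Policy (E : Finset (V × V)) (cap : E → ℝ) (a : ℕ → V → V → Ω → ℝ) where
  /-- planned transmissions per slot, edge and commodity -/
  planned : ℕ → E → V → Ω → ℝ
  /-- actual transmissions of queued packets -/
  actual : ℕ → E → V → Ω → ℝ
  /-- dummy packets, which cost as much as other packets but do not affect the queues -/
  dummy : ℕ → E → V → Ω → ℝ
  /-- queue backlogs `backlog t i k` at the beginning of slot `t` -/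
  backlog : ℕ → V → V → Ω → ℝ
  measurable_planned : ∀ t e k, Measurable (planned t e k)
  measurable_actual : ∀ t e k, Measurable (actual t e k)
  measurable_dummy : ∀ t e k, Measurable (dummy t e k)
  measurable_backlog : ∀ t i k, Measurable (backlog t i k)
  planned_feasible : ∀ t, 1 ≤ t → ∀ ω, (fun e k => planned t e k ω) ∈ feasibleSet E cap
  actual_nonneg : ∀ t, 1 ≤ t → ∀ e k ω, 0 ≤ actual t e k ω
  dummy_nonneg : ∀ t, 1 ≤ t → ∀ e k ω, 0 ≤ dummy t e k ω
  actual_add_dummy_le : ∀ t, 1 ≤ t → ∀ e k ω, actual t e k ω + dummy t e k ω ≤ planned t e k ω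
  /-- only packets that are in the queue can be transmitted -/
  actual_le_backlog : ∀ t, 1 ≤ t → ∀ i k ω,
    outflow E (fun e => actual t e k ω) i ≤ backlog t i k ω
  /-- the network is empty before the first arrivals -/
  backlog_one : ∀ i k ω, backlog 1 i k ω = 0
  /-- packets leave the network at their destination -/
  backlog_self : ∀ t, 1 ≤ t → ∀ k ω, backlog t k k ω = 0
  /-- packets are conserved at all other nodes -/
  backlog_succ : ∀ t, 1 ≤ t → ∀ i k, i ≠ k → ∀ ω,
    backlog (t + 1) i k ω = backlog t i k ω - outflow E (fun e => actual t e k ω) i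
      + inflow E (fun e => actual t e k ω) i + a t i k ω
  /-- planned transmissions are carried out as far as the queues allow, so that the usual queue
  inequality holds -/
  backlog_succ_le : ∀ t, 1 ≤ t → ∀ i k, i ≠ k → ∀ ω,
    backlog (t + 1) i k ω ≤ max (backlog t i k ω - outflow E (fun e => planned t e k ω) i) 0
      + inflow E (fun e => planned t e k ω) i + a t i k ω

variable {E : Finset (V × V)} {cap : E → ℝ} {a : ℕ → V → V → Ω → ℝ}

/-- Total cost up to the horizon `T`: transmission costs (dummy packets included) and terminal
backlog cost `cB` per undelivered packet. -/
def totalCost (c : E → ℝ) (cB : ℝ) (T : ℕ) (π : Policy E cap a) (ω : Ω) : ℝ :=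
  ∑ t ∈ Finset.Icc 1 T, ∑ e : E, ∑ k, (π.actual t e k ω + π.dummy t e k ω) * c e
    + cB * ∑ i, ∑ k, π.backlog T i k ω

/-- Regret against the best policy in the class of all feasible policies. -/
def regret (P : Measure Ω) (c : E → ℝ) (cB : ℝ) (T : ℕ) (π : Policy E cap a) : ℝ :=
  ∫ ω, totalCost c cB T π ω ∂P - ⨅ π' : Policy E cap a, ∫ ω, totalCost c cB T π' ω ∂P

/-! ### The Drift Plus Optimistic Penalty policy -/

open Classical in
/-- Indicator of a cost observation on edge `e` in slot `t`: every edge is observed in the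
exploration slot `0`, later on exactly the edges with a positive planned transmission are. -/
def observed (π : Policy E cap a) (t : ℕ) (e : E) (ω : Ω) : ℝ :=
  if t = 0 ∨ ∃ k, 0 < π.planned t e k ω then 1 else 0

/-- Number of observations of edge `e` before slot `t`. -/
def obsCount (π : Policy E cap a) (t : ℕ) (e : E) (ω : Ω) : ℝ :=
  ∑ τ ∈ Finset.range t, observed π τ e ω

/-- Average of the noisy cost observations `c e + η τ e` of edge `e` made before slot `t`. -/
def avgCost (c : E → ℝ) (η : ℕ → E → Ω → ℝ) (π : Policy E cap a) (t : ℕ) (e : E) (ω : Ω) : ℝ :=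
  (∑ τ ∈ Finset.range t, (c e + η τ e ω) * observed π τ e ω) / obsCount π t e ω

/-- Lower-confidence-bound (optimistic) estimate of the cost of edge `e` in slot `t`. -/
def costEstimate (c : E → ℝ) (η : ℕ → E → Ω → ℝ) (β δ : ℝ) (π : Policy E cap a)
    (t : ℕ) (e : E) (ω : Ω) : ℝ :=
  avgCost c η π t e ω - √(β * Real.log (t / δ) / obsCount π t e ω)

/-- The objective maximized by the policy in slot `t`. -/
def objective (c : E → ℝ) (η : ℕ → E → Ω → ℝ) (β δ ν : ℝ) (π : Policy E cap a)
    (t : ℕ) (ω : Ω) (m : E → V → ℝ) : ℝ :=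
  ∑ e : E, ∑ k, m e k *
    (π.backlog t e.1.1 k ω - π.backlog t e.1.2 k ω - ν * costEstimate c η β δ π t e ω)

/-- `π` is a run of the Drift Plus Optimistic Penalty policy with horizon `T` and parameters
`β`, `δ`, `ν`: in each slot `1 ≤ t ≤ T` its planned transmissions maximize the objective over the
feasible set, and it is causal. Ties between maximizers, and which queued packets are sent if
there are fewer than planned, are resolved in an arbitrary causal way. -/
structure IsDPOP (ℱ : Filtration ℕ (inferInstance : MeasurableSpace Ω)) (c : E → ℝ)
    (η : ℕ → E → Ω → ℝ) (β δ ν : ℝ) (T : ℕ) (π : Policy E cap a) : Prop where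
  isMaxOn : ∀ t, 1 ≤ t → t ≤ T → ∀ ω,
    IsMaxOn (objective c η β δ ν π t ω) (feasibleSet E cap) (fun e k => π.planned t e k ω)
  planned_adapted : ∀ t, 1 ≤ t → t ≤ T → ∀ e k, Measurable[ℱ t] (π.planned t e k)
  backlog_adapted : ∀ t, 1 ≤ t → t ≤ T → ∀ i k, Measurable[ℱ t] (π.backlog t i k)

end DPOP

end

/-!
Write `Q` for the backlogs, `Z` for their Euclidean norm, `ĉ` for the cost estimates. All constants
below are independent of the horizon `T`.

*Benchmark.* Every policy costs at least as much as a static flow: there is a feasible flow `m` that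
supports the arrival rates with `T * ∑ m * c ≤ 𝔼[cost] + O(1)`. The expected transmissions of the
policy, averaged over time, are a feasible flow that supports the rates up to `1 / T` times the terminal
backlog plus `O(1 / T)`. Hoffman's error bound for linear inequalities repairs this flow at a distance proportional
to the defect, with a factor that depends on the topology only; the terminal backlog cost pays for
the repair if it is at least this factor times the sum of the edge costs (`exists_static_cost_le`).

*Transmission costs.* The drift-plus-penalty inequality `lyap_succ_le`, summed over the horizon,
compares the policy with such an `m` at the estimated costs, up to `T / ν = √T`. The passage from
estimated to true costs loses nothing for `m`, because the estimates are optimistic, and for the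
policy the confidence radii of the edges it uses; those edges are observed, so the radii add up to
`O(√(T log T))`. Both statements hold up to deviations of the noise whose means add up to `O(1)`
over the horizon; they are bounded by the exponential supermartingale of the observed noise together with a union over the
possible numbers of observations (`exists_deviation_bound`, `exists_sum_planned_cost_le`).

*Terminal backlog.* While the noise is at most `O(√(log T))`, the penalties `ν * ĉ` are
`O(√(T log T))`, and above a level `θ` of this order the slack in the stability condition gives `Z`
a negative drift. An exponential Lyapunov function shows that `𝔼[Z T] ≤ θ + O(1)`; the event that
the noise is larger has probability `O(1 / T)`, while `Z T = O(T)` always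
(`exists_integral_sqrt_lyap_le`). This bounds the terminal backlog cost and gives rate stability.
-/

namespace DPOP

/-! ### Error bounds for systems of linear inequalities -/

/-- Hoffman's error bound, by Fourier–Motzkin elimination of one variable at a time: the constant
depends only on the coefficients of the system, not on the right-hand side. -/
theorem exists_hoffman_const_fin (n : ℕ) : ∀ {ι : Type*} [Fintype ι] (A : ι → Fin n → ℝ),
    ∃ H, 0 ≤ H ∧ ∀ (b : ι → ℝ) (z : Fin n → ℝ), (∀ i, ∑ j, A i j * z j ≤ b i) →
      ∀ (x : Fin n → ℝ) (r : ℝ), 0 ≤ r → (∀ i, ∑ j, A i j * x j ≤ b i + r) →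
        ∃ y : Fin n → ℝ, (∀ i, ∑ j, A i j * y j ≤ b i) ∧ ∀ j, |y j - x j| ≤ H * r := by
  induction n with
  | zero => exact fun A => ⟨0, le_rfl, fun b z hz x r hr hx => ⟨z, hz, fun j => j.elim0⟩⟩
  | succ n ih =>
    intro ι _ A
    -- A row with vanishing leading coefficient is kept; a row with positive and one with negative
    -- leading coefficient are combined so that the leading coefficients cancel.
    obtain ⟨w, w', hw, hw', hcancel, hzero, hpos⟩ : ∃ w w' : ι × ι → ℝ, (∀ q, 0 ≤ w q) ∧
        (∀ q, 0 ≤ w' q) ∧ (∀ q, w q * A q.1 0 + w' q * A q.2 0 = 0) ∧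
        (∀ i, A i 0 = 0 → w (i, i) = 1 ∧ w' (i, i) = 0) ∧
        (∀ i j, 0 < A i 0 → A j 0 < 0 → w (i, j) = -A j 0 ∧ w' (i, j) = A i 0) := by
      refine ⟨fun q => if A q.1 0 = 0 then 1 else
          if 0 < A q.1 0 ∧ A q.2 0 < 0 then -A q.2 0 else 0,
        fun q => if A q.1 0 = 0 then 0 else
          if 0 < A q.1 0 ∧ A q.2 0 < 0 then A q.1 0 else 0, ?_, ?_, ?_, ?_, ?_⟩
      · intro q; dsimp only; split_ifs with h1 h2
        · norm_num
        · linarith [h2.2]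
        · norm_num
      · intro q; dsimp only; split_ifs with h1 h2
        · norm_num
        · linarith [h2.1]
        · norm_num
      · intro q; dsimp only; split_ifs with h1 h2
        · simp [h1]
        · ring
        · ring
      · intro i hi; simp [hi]
      · intro i j hi hj; simp [hi, hj, hi.ne']
    obtain ⟨H', hH', hyp⟩ := ih (fun (q : ι × ι) (j : Fin n) =>
      w q * A q.1 j.succ + w' q * A q.2 j.succ)
    have comb : ∀ (q : ι × ι) (v : Fin n → ℝ),
        ∑ j, (w q * A q.1 j.succ + w' q * A q.2 j.succ) * v j
          = w q * ∑ j, A q.1 j.succ * v j + w' q * ∑ j, A q.2 j.succ * v j := by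
      intro q v
      rw [Finset.mul_sum, Finset.mul_sum, ← Finset.sum_add_distrib]
      exact Finset.sum_congr rfl fun j _ => by ring
    set W : ℝ := ∑ q, (w q + w' q) with hW
    have hW0 : 0 ≤ W := Finset.sum_nonneg fun q _ => add_nonneg (hw q) (hw' q)
    set g : ι → ℝ := fun i => ((∑ k : Fin n, |A i k.succ|) * (H' * W) + 1) / |A i 0| with hg
    have hg0 : ∀ i, 0 ≤ g i := fun i => by
      have : 0 ≤ ∑ k : Fin n, |A i k.succ| := Finset.sum_nonneg fun _ _ => abs_nonneg _
      positivity
    set H : ℝ := H' * W + ∑ i, g i with hH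
    have hgH : ∀ i, g i ≤ H := fun i => by
      have := Finset.single_le_sum (f := g) (fun i _ => hg0 i) (Finset.mem_univ i)
      have : 0 ≤ H' * W := by positivity
      linarith
    have hH0 : 0 ≤ H := add_nonneg (by positivity) (Finset.sum_nonneg fun i _ => hg0 i)
    refine ⟨H, hH0, fun b z hz x r hr hx => ?_⟩
    simp only [Fin.sum_univ_succ] at hz hx
    obtain ⟨y, hy, hyx⟩ := hyp (fun q => w q * b q.1 + w' q * b q.2) (fun j => z j.succ)
      (by
        intro q
        rw [comb]
        have h1 := mul_le_mul_of_nonneg_left (hz q.1) (hw q)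
        have h2 := mul_le_mul_of_nonneg_left (hz q.2) (hw' q)
        have h3 : (w q * A q.1 0 + w' q * A q.2 0) * z 0 = 0 := by rw [hcancel q, zero_mul]
        nlinarith) (fun j => x j.succ) (W * r) (by positivity)
      (by
        intro q
        rw [comb]
        have h1 := mul_le_mul_of_nonneg_left (hx q.1) (hw q)
        have h2 := mul_le_mul_of_nonneg_left (hx q.2) (hw' q)
        have h3 : (w q * A q.1 0 + w' q * A q.2 0) * x 0 = 0 := by rw [hcancel q, zero_mul]
        have h4 : w q + w' q ≤ W := Finset.single_le_sum (f := fun q => w q + w' q)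
          (fun q _ => add_nonneg (hw q) (hw' q)) (Finset.mem_univ q)
        have h5 := mul_le_mul_of_nonneg_right h4 hr
        nlinarith)
    simp only [comb] at hy
    have hdiff : ∀ i, |∑ j : Fin n, A i j.succ * y j - ∑ j : Fin n, A i j.succ * x j.succ|
        ≤ (∑ k : Fin n, |A i k.succ|) * (H' * W) * r := by
      intro i
      rw [← Finset.sum_sub_distrib]
      refine (Finset.abs_sum_le_sum_abs _ _).trans ?_
      rw [Finset.sum_mul, Finset.sum_mul]
      refine Finset.sum_le_sum fun j _ => ?_
      rw [← mul_sub, abs_mul, mul_assoc]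
      exact mul_le_mul_of_nonneg_left ((hyx j).trans_eq (by ring)) (abs_nonneg _)
    have hgr : ∀ i, A i 0 ≠ 0 → (∑ k : Fin n, |A i k.succ|) * (H' * W) * r + r
        ≤ |A i 0| * (H * r) := by
      intro i hi
      have h1 : (∑ k : Fin n, |A i k.succ|) * (H' * W) + 1 = |A i 0| * g i := by
        rw [hg]; field_simp
      have h2 : |A i 0| * g i ≤ |A i 0| * H := mul_le_mul_of_nonneg_left (hgH i) (abs_nonneg _)
      nlinarith
    -- the eliminated coordinate is the largest of its lower bounds and `x 0 - H * r`
    set lo : Option ι → ℝ := fun o => o.elim (x 0 - H * r)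
      (fun j => if A j 0 < 0 then (b j - ∑ k, A j k.succ * y k) / A j 0 else x 0 - H * r) with hlo
    have hne : (Finset.univ : Finset (Option ι)).Nonempty := ⟨none, Finset.mem_univ _⟩
    set y0 : ℝ := Finset.univ.sup' hne lo with hy0
    have hlow : ∀ o, lo o ≤ y0 := fun o => Finset.le_sup' lo (Finset.mem_univ o)
    have hup : ∀ u, (x 0 - H * r ≤ u) → (∀ j, A j 0 < 0 →
        (b j - ∑ k, A j k.succ * y k) / A j 0 ≤ u) → y0 ≤ u := by
      intro u h1 h2
      refine Finset.sup'_le hne lo fun o _ => ?_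
      cases o with
      | none => exact h1
      | some j =>
        simp only [hlo, Option.elim]
        split_ifs with hj
        · exact h2 j hj
        · exact h1
    have hHr : 0 ≤ H * r := by positivity
    refine ⟨Fin.cons y0 y, fun i => ?_, fun j => ?_⟩
    · rw [Fin.sum_univ_succ]
      simp only [Fin.cons_zero, Fin.cons_succ]
      rcases lt_trichotomy (A i 0) 0 with hi | hi | hi
      · have h := hlow (some i)
        simp only [hlo, Option.elim, hi, if_true] at h
        rw [div_le_iff_of_neg hi] at h
        linarith
      · have h := hy (i, i)
        simp only [(hzero i hi).1, (hzero i hi).2] at h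
        rw [hi]; linarith
      · have h : y0 ≤ (b i - ∑ k, A i k.succ * y k) / A i 0 := by
          refine hup _ ?_ fun j hj => ?_
          · rw [le_div_iff₀ hi]
            have h1 := hgr i hi.ne'
            rw [abs_of_pos hi] at h1
            have h2 := (abs_le.1 (hdiff i)).2
            have h3 := hx i
            nlinarith
          · have h1 := hy (i, j)
            simp only [(hpos i j hi hj).1, (hpos i j hi hj).2] at h1
            rw [div_le_iff_of_neg hj, div_mul_eq_mul_div, div_le_iff₀ hi]
            nlinarith
        rw [le_div_iff₀ hi] at h
        linarith
    · refine Fin.cases ?_ (fun j => ?_) j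
      · simp only [Fin.cons_zero]
        rw [abs_le]
        constructor
        · have := hlow none
          simp only [hlo, Option.elim] at this
          linarith
        · suffices y0 ≤ x 0 + H * r by linarith
          refine hup _ (by linarith) fun j hj => ?_
          rw [div_le_iff_of_neg hj]
          have h1 := hgr j hj.ne
          rw [abs_of_neg hj] at h1
          have h2 := (abs_le.1 (hdiff j)).2
          have h3 := hx j
          nlinarith
      · simp only [Fin.cons_succ]
        refine (hyx j).trans ?_
        have : 0 ≤ ∑ i, g i := Finset.sum_nonneg fun i _ => hg0 i
        rw [hH]
        nlinarith

/-- Hoffman's error bound: a point that violates each of finitely many linear inequalities by at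
most `r` is within distance `H * r` of the solution set, if this set is nonempty. The constant `H`
is the same for all right-hand sides. -/
theorem exists_hoffman_const {ι κ : Type*} [Fintype ι] [Fintype κ]
    (A : ι → (κ → ℝ) →ₗ[ℝ] ℝ) :
    ∃ H, 0 ≤ H ∧ ∀ (b : ι → ℝ) (z : κ → ℝ), (∀ i, A i z ≤ b i) →
      ∀ (x : κ → ℝ) (r : ℝ), 0 ≤ r → (∀ i, A i x ≤ b i + r) →
        ∃ y : κ → ℝ, (∀ i, A i y ≤ b i) ∧ ∀ j, |y j - x j| ≤ H * r := by
  classical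
  let φ := Fintype.equivFin κ
  have key : ∀ i (v : Fin (Fintype.card κ) → ℝ),
      ∑ j, A i (fun l => if φ.symm j = l then 1 else 0) * v j = A i (v ∘ φ) := by
    intro i v
    rw [LinearMap.pi_apply_eq_sum_univ (A i) (v ∘ φ), ← φ.symm.sum_comp]
    exact Finset.sum_congr rfl fun j _ => by simp [mul_comm]
  obtain ⟨H, hH, h⟩ := exists_hoffman_const_fin (Fintype.card κ)
    (fun i j => A i (fun l => if φ.symm j = l then 1 else 0))
  refine ⟨H, hH, fun b z hz x r hr hx => ?_⟩
  simp only [key] at h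
  have hcomp : ∀ v : κ → ℝ, (v ∘ φ.symm) ∘ φ = v := fun v => by ext; simp
  obtain ⟨y, hy, hyx⟩ := h b (z ∘ φ.symm) (by simpa only [hcomp] using hz) (x ∘ φ.symm) r hr
    (by simpa only [hcomp] using hx)
  exact ⟨y ∘ φ, hy, fun j => by simpa using hyx (φ j)⟩

section

/-! ### Flows -/

section Flow

variable {V : Type*} [DecidableEq V] {E : Finset (V × V)}

theorem outflow_mono {f g : E → ℝ} (h : ∀ e, f e ≤ g e) (i : V) :
    outflow E f i ≤ outflow E g i :=
  Finset.sum_le_sum fun e _ => h e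

theorem inflow_mono {f g : E → ℝ} (h : ∀ e, f e ≤ g e) (i : V) :
    inflow E f i ≤ inflow E g i :=
  Finset.sum_le_sum fun e _ => h e

theorem outflow_nonneg {f : E → ℝ} (h : ∀ e, 0 ≤ f e) (i : V) : 0 ≤ outflow E f i :=
  Finset.sum_nonneg fun e _ => h e

theorem inflow_nonneg {f : E → ℝ} (h : ∀ e, 0 ≤ f e) (i : V) : 0 ≤ inflow E f i :=
  Finset.sum_nonneg fun e _ => h e

theorem outflow_le_sum {f : E → ℝ} (h : ∀ e, 0 ≤ f e) (i : V) : outflow E f i ≤ ∑ e, f e :=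
  Finset.sum_le_univ_sum_of_nonneg h

theorem inflow_le_sum {f : E → ℝ} (h : ∀ e, 0 ≤ f e) (i : V) : inflow E f i ≤ ∑ e, f e :=
  Finset.sum_le_univ_sum_of_nonneg h

end Flow

section Capacity

variable {V : Type*} [Fintype V] {E : Finset (V × V)} {cap : E → ℝ}

theorem le_cap {m : E → V → ℝ} (hm : m ∈ feasibleSet E cap) (e : E) (k : V) : m e k ≤ cap e :=
  (Finset.single_le_sum (f := fun k => m e k) (fun k _ => hm.1 e k) (Finset.mem_univ k)).trans
    (hm.2 e)

theorem cap_nonneg {m : E → V → ℝ} (hm : m ∈ feasibleSet E cap) (e : E) : 0 ≤ cap e :=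
  (Finset.sum_nonneg fun k _ => hm.1 e k).trans (hm.2 e)

end Capacity

variable {V : Type*} [Fintype V] [DecidableEq V] {Ω : Type*} [MeasurableSpace Ω]
  {E : Finset (V × V)} {cap : E → ℝ} {a : ℕ → V → V → Ω → ℝ}

theorem sum_mul_outflow (q : V → ℝ) (f : E → ℝ) :
    ∑ i, q i * outflow E f i = ∑ e : E, f e * q e.1.1 := by
  simp only [outflow, Finset.mul_sum, Finset.sum_filter]
  rw [Finset.sum_comm]
  exact Finset.sum_congr rfl fun e _ => by simp [mul_comm]

theorem sum_mul_inflow (q : V → ℝ) (f : E → ℝ) :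
    ∑ i, q i * inflow E f i = ∑ e : E, f e * q e.1.2 := by
  simp only [inflow, Finset.mul_sum, Finset.sum_filter]
  rw [Finset.sum_comm]
  exact Finset.sum_congr rfl fun e _ => by simp [mul_comm]

/-- Summation by parts: backlogs weighted with net outflows are backlog differences along edges
weighted with transmissions. -/
theorem sum_mul_outflow_sub_inflow (q : V → V → ℝ) (f : E → V → ℝ) :
    ∑ i, ∑ k, q i k * (outflow E (fun e => f e k) i - inflow E (fun e => f e k) i)
      = ∑ e : E, ∑ k, f e k * (q e.1.1 k - q e.1.2 k) := by
  rw [Finset.sum_comm, Finset.sum_comm (γ := E)]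
  refine Finset.sum_congr rfl fun k _ => ?_
  simp only [mul_sub, Finset.sum_sub_distrib]
  rw [sum_mul_outflow (fun i => q i k), sum_mul_inflow (fun i => q i k)]

theorem outflow_le_sum_cap {m : E → V → ℝ} (hm : m ∈ feasibleSet E cap) (i k : V) :
    outflow E (fun e => m e k) i ≤ ∑ e, cap e :=
  (outflow_mono (fun e => le_cap hm e k) i).trans (outflow_le_sum (cap_nonneg hm) i)

theorem inflow_le_sum_cap {m : E → V → ℝ} (hm : m ∈ feasibleSet E cap) (i k : V) :
    inflow E (fun e => m e k) i ≤ ∑ e, cap e :=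
  (inflow_mono (fun e => le_cap hm e k) i).trans (inflow_le_sum (cap_nonneg hm) i)

/-! ### Pathwise bounds on the backlogs -/

namespace Policy

theorem cap_nonneg (π : Policy E cap a) (ω : Ω) (e : E) : 0 ≤ cap e :=
  DPOP.cap_nonneg (π.planned_feasible 1 le_rfl ω) e

theorem actual_le_planned (π : Policy E cap a) {t : ℕ} (ht : 1 ≤ t) (e : E) (k : V) (ω : Ω) :
    π.actual t e k ω ≤ π.planned t e k ω := by
  linarith [π.actual_add_dummy_le t ht e k ω, π.dummy_nonneg t ht e k ω]

theorem actual_mem_feasibleSet (π : Policy E cap a) {t : ℕ} (ht : 1 ≤ t) (ω : Ω) :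
    (fun e k => π.actual t e k ω) ∈ feasibleSet E cap :=
  ⟨fun e k => π.actual_nonneg t ht e k ω, fun e =>
    (Finset.sum_le_sum fun k _ => π.actual_le_planned ht e k ω).trans
      ((π.planned_feasible t ht ω).2 e)⟩

theorem backlog_nonneg (π : Policy E cap a) {t : ℕ} (ht : 1 ≤ t) (i k : V) (ω : Ω) :
    0 ≤ π.backlog t i k ω :=
  (outflow_nonneg (fun e => π.actual_nonneg t ht e k ω) i).trans
    (π.actual_le_backlog t ht i k ω)

theorem backlog_succ_le_add (π : Policy E cap a) {A : ℝ} {t : ℕ} (ht : 1 ≤ t) {ω : Ω}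
    (ha : ∀ i k, 0 ≤ a t i k ω ∧ a t i k ω ≤ A) (i k : V) :
    π.backlog (t + 1) i k ω ≤ π.backlog t i k ω + (∑ e, cap e + A) := by
  have hf := π.actual_mem_feasibleSet ht ω
  have hS : 0 ≤ ∑ e, cap e := Finset.sum_nonneg fun e _ => π.cap_nonneg ω e
  have hA : 0 ≤ A := (ha i k).1.trans (ha i k).2
  rcases eq_or_ne i k with rfl | hik
  · rw [π.backlog_self (t + 1) (by omega), π.backlog_self t ht]
    linarith
  · rw [π.backlog_succ t ht i k hik]
    have h1 := inflow_le_sum_cap hf i k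
    have h2 := outflow_nonneg (fun e => π.actual_nonneg t ht e k ω) i
    linarith [(ha i k).2]

theorem backlog_le (π : Policy E cap a) {A : ℝ} {ω : Ω}
    (ha : ∀ t, 1 ≤ t → ∀ i k, 0 ≤ a t i k ω ∧ a t i k ω ≤ A) {t : ℕ} (ht : 1 ≤ t) (i k : V) :
    π.backlog t i k ω ≤ t * (∑ e, cap e + A) := by
  induction t, ht using Nat.le_induction with
  | base =>
    have hS : 0 ≤ ∑ e, cap e := Finset.sum_nonneg fun e _ => π.cap_nonneg ω e
    have hA : 0 ≤ A := (ha 1 le_rfl i k).1.trans (ha 1 le_rfl i k).2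
    rw [π.backlog_one]
    positivity
  | succ t ht ih =>
    have := π.backlog_succ_le_add ht (ha t ht) i k
    push_cast
    linarith

/-- The quadratic Lyapunov function. -/
noncomputable def lyap (π : Policy E cap a) (t : ℕ) (ω : Ω) : ℝ :=
  ∑ i, ∑ k, π.backlog t i k ω ^ 2

theorem lyap_nonneg (π : Policy E cap a) (t : ℕ) (ω : Ω) : 0 ≤ π.lyap t ω :=
  Finset.sum_nonneg fun _ _ => Finset.sum_nonneg fun _ _ => sq_nonneg _

theorem lyap_one (π : Policy E cap a) (ω : Ω) : π.lyap 1 ω = 0 := by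
  simp [lyap, π.backlog_one]

theorem sq_backlog_le_lyap (π : Policy E cap a) (t : ℕ) (i k : V) (ω : Ω) :
    π.backlog t i k ω ^ 2 ≤ π.lyap t ω :=
  (Finset.single_le_sum (f := fun k => π.backlog t i k ω ^ 2) (fun _ _ => sq_nonneg _)
    (Finset.mem_univ k)).trans
    (Finset.single_le_sum (f := fun i => ∑ k, π.backlog t i k ω ^ 2)
      (fun _ _ => Finset.sum_nonneg fun _ _ => sq_nonneg _) (Finset.mem_univ i))

theorem backlog_le_sqrt_lyap (π : Policy E cap a) (t : ℕ) (i k : V) (ω : Ω) :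
    π.backlog t i k ω ≤ √(π.lyap t ω) :=
  Real.le_sqrt_of_sq_le (π.sq_backlog_le_lyap t i k ω)

theorem sum_backlog_le (π : Policy E cap a) (t : ℕ) (ω : Ω) :
    ∑ i, ∑ k, π.backlog t i k ω ≤ (Fintype.card V : ℝ) ^ 2 * √(π.lyap t ω) := by
  calc ∑ i, ∑ k, π.backlog t i k ω ≤ ∑ _i : V, ∑ _k : V, √(π.lyap t ω) :=
        Finset.sum_le_sum fun i _ => Finset.sum_le_sum fun k _ => π.backlog_le_sqrt_lyap t i k ω
    _ = (Fintype.card V : ℝ) ^ 2 * √(π.lyap t ω) := by simp; ring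

/-- The Euclidean norm of the backlogs is at most their sum. -/
theorem sqrt_lyap_le_sum_backlog (π : Policy E cap a) {t : ℕ} (ht : 1 ≤ t) (ω : Ω) :
    √(π.lyap t ω) ≤ ∑ i, ∑ k, π.backlog t i k ω := by
  have h0 : ∀ i, 0 ≤ ∑ k, π.backlog t i k ω :=
    fun i => Finset.sum_nonneg fun k _ => π.backlog_nonneg ht i k ω
  refine Real.sqrt_le_iff.2 ⟨Finset.sum_nonneg fun i _ => h0 i, ?_⟩
  calc π.lyap t ω ≤ ∑ i, (∑ k, π.backlog t i k ω) ^ 2 :=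
        Finset.sum_le_sum fun i _ => Finset.sum_sq_le_sq_sum_of_nonneg
          fun k _ => π.backlog_nonneg ht i k ω
    _ ≤ _ := Finset.sum_sq_le_sq_sum_of_nonneg fun i _ => h0 i

theorem sqrt_lyap_succ_le (π : Policy E cap a) {A : ℝ} {t : ℕ} (ht : 1 ≤ t) {ω : Ω} (hA : 0 ≤ A)
    (ha : ∀ i k, 0 ≤ a t i k ω ∧ a t i k ω ≤ A) :
    √(π.lyap (t + 1) ω) ≤ √(π.lyap t ω) + (Fintype.card V : ℝ) ^ 2 * (∑ e, cap e + A) := by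
  set Z := √(π.lyap t ω) with hZ
  set d := ∑ e, cap e + A with hd
  set n : ℝ := (Fintype.card V : ℝ) ^ 2 with hn
  have hd0 : 0 ≤ d := add_nonneg (Finset.sum_nonneg fun e _ => π.cap_nonneg ω e) hA
  have hZ0 : 0 ≤ Z := Real.sqrt_nonneg _
  have hZL : π.lyap t ω = Z ^ 2 := (Real.sq_sqrt (π.lyap_nonneg t ω)).symm
  have hnn : n ≤ n ^ 2 := by
    have : Fintype.card V ^ 2 ≤ (Fintype.card V ^ 2) ^ 2 := Nat.le_self_pow two_ne_zero _
    rw [hn]; exact_mod_cast this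
  refine Real.sqrt_le_iff.2 ⟨by positivity, ?_⟩
  calc π.lyap (t + 1) ω
      ≤ ∑ i, ∑ k, (π.backlog t i k ω ^ 2 + (2 * d * Z + d ^ 2)) := by
        refine Finset.sum_le_sum fun i _ => Finset.sum_le_sum fun k _ => ?_
        have h1 := π.backlog_succ_le_add ht ha i k
        have h2 := π.backlog_nonneg (t := t + 1) (by omega) i k ω
        have h3 := mul_le_mul_of_nonneg_left (π.backlog_le_sqrt_lyap t i k ω) hd0
        nlinarith
    _ = Z ^ 2 + n * (2 * d * Z + d ^ 2) := by
        simp only [Finset.sum_add_distrib, ← hZL, lyap]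
        simp [hn]; ring
    _ ≤ (Z + n * d) ^ 2 := by nlinarith [sq_nonneg d]

end Policy

/-! ### Lyapunov drift -/

theorem sq_backlog_succ_le (π : Policy E cap a) {A : ℝ} {t : ℕ} (ht : 1 ≤ t) {ω : Ω}
    (ha : ∀ i k, 0 ≤ a t i k ω ∧ a t i k ω ≤ A) (i k : V) :
    π.backlog (t + 1) i k ω ^ 2 ≤ π.backlog t i k ω ^ 2 + 2 * (∑ e, cap e + A) ^ 2
      + 2 * (π.backlog t i k ω * (a t i k ω - (outflow E (fun e => π.planned t e k ω) i
        - inflow E (fun e => π.planned t e k ω) i))) := by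
  rcases eq_or_ne i k with rfl | hik
  · rw [π.backlog_self (t + 1) (by omega), π.backlog_self t ht]
    nlinarith [sq_nonneg (∑ e, cap e + A)]
  · have hf := π.planned_feasible t ht ω
    have h0 := π.backlog_nonneg (t := t + 1) (by omega) i k ω
    have hq := π.backlog_nonneg ht i k ω
    have h := π.backlog_succ_le t ht i k hik ω
    have hin0 := inflow_nonneg (fun e => hf.1 e k) i
    have hout0 := outflow_nonneg (fun e => hf.1 e k) i
    have hin := inflow_le_sum_cap hf i k
    have hout := outflow_le_sum_cap hf i k
    obtain ⟨ha0, haA⟩ := ha i k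
    set q := π.backlog t i k ω
    set o := outflow E (fun e => π.planned t e k ω) i
    set p := inflow E (fun e => π.planned t e k ω) i
    set M := max (q - o) 0 with hM
    have hM0 : 0 ≤ M := le_max_right _ _
    have hMq : M ≤ q := max_le (by linarith) hq
    have hM2 : M ^ 2 ≤ (q - o) ^ 2 := by
      rcases max_cases (q - o) 0 with ⟨h, -⟩ | ⟨h, -⟩
      · rw [hM, h]
      · rw [hM, h]; nlinarith [sq_nonneg (q - o)]
    have hx0 : 0 ≤ p + a t i k ω := by linarith
    have h1 : π.backlog (t + 1) i k ω ^ 2 ≤ (M + (p + a t i k ω)) ^ 2 :=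
      pow_le_pow_left₀ h0 (by linarith) 2
    have h2 : M * (p + a t i k ω) ≤ q * (p + a t i k ω) := mul_le_mul_of_nonneg_right hMq hx0
    have h3 : (p + a t i k ω) ^ 2 ≤ (∑ e, cap e + A) ^ 2 :=
      pow_le_pow_left₀ hx0 (by linarith) 2
    have h4 : o ^ 2 ≤ (∑ e, cap e + A) ^ 2 := pow_le_pow_left₀ hout0 (by linarith) 2
    nlinarith

/-- Drift-plus-penalty inequality: the policy's decision is compared with an arbitrary feasible
flow `m` that supports the arrival rates with slack `ε`. -/
theorem lyap_succ_le (π : Policy E cap a) {A : ℝ} {t : ℕ} (ht : 1 ≤ t) {ω : Ω}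
    (ha : ∀ i k, 0 ≤ a t i k ω ∧ a t i k ω ≤ A) {c : E → ℝ} {η : ℕ → E → Ω → ℝ} {β δ ν : ℝ}
    (hmax : IsMaxOn (objective c η β δ ν π t ω) (feasibleSet E cap)
      (fun e k => π.planned t e k ω))
    {rate : V → V → ℝ} {ε : ℝ} {m : E → V → ℝ} (hm : m ∈ feasibleSet E cap)
    (hslack : ∀ i k, i ≠ k →
      inflow E (fun e => m e k) i + rate i k + ε ≤ outflow E (fun e => m e k) i) :
    π.lyap (t + 1) ω ≤ π.lyap t ω + 2 * ((Fintype.card V : ℝ) ^ 2 * (∑ e, cap e + A) ^ 2)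
      + 2 * ∑ i, ∑ k, π.backlog t i k ω * (a t i k ω - rate i k)
      - 2 * ε * ∑ i, ∑ k, π.backlog t i k ω
      + 2 * ν * ∑ e, ∑ k, (m e k - π.planned t e k ω) * costEstimate c η β δ π t e ω := by
  have hstep : ∀ i k, π.backlog (t + 1) i k ω ^ 2 ≤
      π.backlog t i k ω ^ 2 + 2 * (∑ e, cap e + A) ^ 2
      + 2 * (π.backlog t i k ω * (a t i k ω - rate i k)) - 2 * ε * π.backlog t i k ω
      + 2 * (π.backlog t i k ω * (outflow E (fun e => m e k) i - inflow E (fun e => m e k) i))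
      - 2 * (π.backlog t i k ω * (outflow E (fun e => π.planned t e k ω) i
        - inflow E (fun e => π.planned t e k ω) i)) := by
    intro i k
    have h1 := sq_backlog_succ_le π ht ha i k
    have h2 : 0 ≤ π.backlog t i k ω * (outflow E (fun e => m e k) i
        - inflow E (fun e => m e k) i - rate i k - ε) := by
      rcases eq_or_ne i k with rfl | hik
      · rw [π.backlog_self t ht, zero_mul]
      · exact mul_nonneg (π.backlog_nonneg ht i k ω) (by linarith [hslack i k hik])
    linarith
  have hsum := Finset.sum_le_sum fun i (_ : i ∈ Finset.univ) =>
    Finset.sum_le_sum fun k (_ : k ∈ Finset.univ) => hstep i k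
  simp only [Finset.sum_add_distrib, Finset.sum_sub_distrib, ← Finset.mul_sum] at hsum
  rw [sum_mul_outflow_sub_inflow (fun i k => π.backlog t i k ω) m,
    sum_mul_outflow_sub_inflow (fun i k => π.backlog t i k ω)
      (fun e k => π.planned t e k ω)] at hsum
  have hobj : objective c η β δ ν π t ω m ≤
    objective c η β δ ν π t ω (fun e k => π.planned t e k ω) := hmax hm
  have hsplit : ∀ f : E → V → ℝ, objective c η β δ ν π t ω f =
      ∑ e : E, ∑ k, f e k * (π.backlog t e.1.1 k ω - π.backlog t e.1.2 k ω)
        - ν * ∑ e, ∑ k, f e k * costEstimate c η β δ π t e ω := by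
    intro f
    simp only [objective, Finset.mul_sum, ← Finset.sum_sub_distrib]
    exact Finset.sum_congr rfl fun e _ => Finset.sum_congr rfl fun k _ => by ring
  rw [hsplit, hsplit] at hobj
  simp only [sub_mul, Finset.sum_sub_distrib]
  simp only [Finset.sum_const, Finset.card_univ, nsmul_eq_mul] at hsum
  unfold Policy.lyap
  nlinarith

end

section

/-! ### Integrability -/

theorem integrable_of_nonneg_of_le {Ω : Type*} [MeasurableSpace Ω] {P : Measure Ω}
    [IsFiniteMeasure P] {f : Ω → ℝ} {C : ℝ}
    (hf : Measurable f) (h0 : ∀ ω, 0 ≤ f ω) (hC : ∀ ω, f ω ≤ C) : Integrable f P :=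
  Integrable.of_bound hf.aestronglyMeasurable C
    (ae_of_all _ fun ω => by rw [Real.norm_of_nonneg (h0 ω)]; exact hC ω)

section Model

variable {V : Type*} {Ω : Type*} [mΩ : MeasurableSpace Ω]
  {E : Finset (V × V)} {a : ℕ → V → V → Ω → ℝ} {P : Measure Ω} {ℱ : Filtration ℕ mΩ}
  {rate : V → V → ℝ} {η : ℕ → E → Ω → ℝ} {σ : NNReal}

theorem IsModel.measurable_arrival (hM : IsModel E P ℱ a rate η σ) {t : ℕ} (ht : 1 ≤ t)
    (i k : V) : Measurable (a t i k) :=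
  (hM.arrival_adapted t ht i k).mono (ℱ.le _) le_rfl

theorem IsModel.integrable_arrival [IsFiniteMeasure P] (hM : IsModel E P ℱ a rate η σ) {t : ℕ}
    (ht : 1 ≤ t) (i k : V) : Integrable (a t i k) P := by
  obtain ⟨A, hA⟩ := hM.arrival_bounded
  exact integrable_of_nonneg_of_le (hM.measurable_arrival ht i k)
    (fun ω => hM.arrival_nonneg t ht i k ω) (fun ω => hA t ht i k ω)

theorem IsModel.rate_nonneg (hM : IsModel E P ℱ a rate η σ) (i k : V) : 0 ≤ rate i k := by
  rw [← hM.arrival_mean 1 le_rfl i k]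
  exact integral_nonneg fun ω => hM.arrival_nonneg 1 le_rfl i k ω

end Model

variable {V : Type*} [Fintype V] [DecidableEq V] {Ω : Type*} [mΩ : MeasurableSpace Ω]
  {E : Finset (V × V)} {cap : E → ℝ} {a : ℕ → V → V → Ω → ℝ}

section Integrable

variable {P : Measure Ω} [IsProbabilityMeasure P] {ℱ : Filtration ℕ mΩ} {rate : V → V → ℝ}
  {η : ℕ → E → Ω → ℝ} {σ : NNReal}

theorem Policy.integrable_planned (π : Policy E cap a) {t : ℕ} (ht : 1 ≤ t) (e : E) (k : V) :
    Integrable (π.planned t e k) P :=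
  integrable_of_nonneg_of_le (π.measurable_planned t e k)
    (fun ω => (π.planned_feasible t ht ω).1 e k) (fun ω => le_cap (π.planned_feasible t ht ω) e k)

theorem Policy.integrable_actual (π : Policy E cap a) {t : ℕ} (ht : 1 ≤ t) (e : E) (k : V) :
    Integrable (π.actual t e k) P :=
  integrable_of_nonneg_of_le (π.measurable_actual t e k)
    (fun ω => π.actual_nonneg t ht e k ω)
    (fun ω => le_cap (π.actual_mem_feasibleSet ht ω) e k)

theorem Policy.integrable_dummy (π : Policy E cap a) {t : ℕ} (ht : 1 ≤ t) (e : E) (k : V) :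
    Integrable (π.dummy t e k) P :=
  integrable_of_nonneg_of_le (C := cap e) (π.measurable_dummy t e k)
    (fun ω => π.dummy_nonneg t ht e k ω)
    (fun ω => by
      linarith [le_cap (π.planned_feasible t ht ω) e k, π.actual_nonneg t ht e k ω,
        π.actual_add_dummy_le t ht e k ω])

theorem Policy.integrable_backlog (hM : IsModel E P ℱ a rate η σ) (π : Policy E cap a) {t : ℕ}
    (ht : 1 ≤ t) (i k : V) : Integrable (π.backlog t i k) P := by
  obtain ⟨A, hA⟩ := hM.arrival_bounded
  exact integrable_of_nonneg_of_le (π.measurable_backlog t i k)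
    (fun ω => π.backlog_nonneg ht i k ω)
    (fun ω => π.backlog_le (fun t ht i k => ⟨hM.arrival_nonneg t ht i k ω, hA t ht i k ω⟩) ht i k)

theorem integral_totalCost (hM : IsModel E P ℱ a rate η σ) (π : Policy E cap a) (c : E → ℝ)
    (cB : ℝ) {T : ℕ} (hT : 1 ≤ T) :
    Integrable (totalCost c cB T π) P ∧ ∫ ω, totalCost c cB T π ω ∂P =
      ∑ t ∈ Finset.Icc 1 T, ∑ e, ∑ k,
        (∫ ω, π.actual t e k ω ∂P + ∫ ω, π.dummy t e k ω ∂P) * c e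
      + cB * ∑ i, ∑ k, ∫ ω, π.backlog T i k ω ∂P := by
  have h1 : ∀ t ∈ Finset.Icc 1 T, ∀ e k,
      Integrable (fun ω => (π.actual t e k ω + π.dummy t e k ω) * c e) P := fun t ht e k =>
    ((π.integrable_actual (Finset.mem_Icc.1 ht).1 e k).add
      (π.integrable_dummy (Finset.mem_Icc.1 ht).1 e k)).mul_const _
  have h2 : Integrable (fun ω => ∑ t ∈ Finset.Icc 1 T, ∑ e, ∑ k,
      (π.actual t e k ω + π.dummy t e k ω) * c e) P :=
    integrable_finsetSum _ fun t ht => integrable_finsetSum _ fun e _ =>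
      integrable_finsetSum _ fun k _ => h1 t ht e k
  have h3 : Integrable (fun ω => cB * ∑ i, ∑ k, π.backlog T i k ω) P :=
    (integrable_finsetSum _ fun i _ => integrable_finsetSum _ fun k _ =>
      π.integrable_backlog hM hT i k).const_mul _
  refine ⟨h2.add h3, ?_⟩
  simp only [totalCost]
  rw [integral_add h2 h3, integral_const_mul, integral_finsetSum _ fun i _ =>
    integrable_finsetSum _ fun k _ => π.integrable_backlog hM hT i k,
    integral_finsetSum _ fun t ht => integrable_finsetSum _ fun e _ =>
      integrable_finsetSum _ fun k _ => h1 t ht e k]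
  congr 1
  · refine Finset.sum_congr rfl fun t ht => ?_
    rw [integral_finsetSum _ fun e _ => integrable_finsetSum _ fun k _ => h1 t ht e k]
    refine Finset.sum_congr rfl fun e _ => ?_
    rw [integral_finsetSum _ fun k _ => h1 t ht e k]
    refine Finset.sum_congr rfl fun k _ => ?_
    rw [integral_mul_const, integral_add (π.integrable_actual (Finset.mem_Icc.1 ht).1 e k)
      (π.integrable_dummy (Finset.mem_Icc.1 ht).1 e k)]
  · congr 1
    exact Finset.sum_congr rfl fun i _ => integral_finsetSum _ fun k _ =>
      π.integrable_backlog hM hT i k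

theorem totalCost_nonneg (π : Policy E cap a) {c : E → ℝ} (hc : ∀ e, 0 ≤ c e) {cB : ℝ}
    (hcB : 0 ≤ cB) {T : ℕ} (hT : 1 ≤ T) (ω : Ω) : 0 ≤ totalCost c cB T π ω := by
  refine add_nonneg (Finset.sum_nonneg fun t ht => Finset.sum_nonneg fun e _ =>
    Finset.sum_nonneg fun k _ => mul_nonneg (add_nonneg ?_ ?_) (hc e))
    (mul_nonneg hcB (Finset.sum_nonneg fun i _ => Finset.sum_nonneg fun k _ =>
      π.backlog_nonneg hT i k ω))
  · exact π.actual_nonneg t (Finset.mem_Icc.1 ht).1 e k ω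
  · exact π.dummy_nonneg t (Finset.mem_Icc.1 ht).1 e k ω

end Integrable

/-! ### The static benchmark -/

/-- The feasible static flow `m` supports the arrival rates. -/
def Supports (cap : E → ℝ) (rate : V → V → ℝ) (m : E → V → ℝ) : Prop :=
  m ∈ feasibleSet E cap ∧ ∀ i k, i ≠ k →
    inflow E (fun e => m e k) i + rate i k ≤ outflow E (fun e => m e k) i

/-- A feasible flow that fails to support the rates by at most `r` is within `H * r` of a flow
that supports them, where `H` depends on the topology only. -/
theorem exists_flow_repair_const (E : Finset (V × V)) :
    ∃ H, 0 ≤ H ∧ ∀ (cap : E → ℝ) (rate : V → V → ℝ), (∃ m, Supports cap rate m) →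
      ∀ f ∈ feasibleSet E cap, ∀ r, 0 ≤ r → (∀ i k, i ≠ k →
        inflow E (fun e => f e k) i + rate i k ≤ outflow E (fun e => f e k) i + r) →
      ∃ m, Supports cap rate m ∧ ∀ e k, |m e k - f e k| ≤ H * r := by
  let A : E ⊕ (E × V) ⊕ (V × V) → (E × V → ℝ) →ₗ[ℝ] ℝ := fun s => match s with
    | .inl e => ∑ k, LinearMap.proj (e, k)
    | .inr (.inl q) => -LinearMap.proj q
    | .inr (.inr q) => if q.1 = q.2 then 0 else
        ∑ e : E with e.1.2 = q.1, LinearMap.proj (e, q.2)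
          - ∑ e : E with e.1.1 = q.1, LinearMap.proj (e, q.2)
  obtain ⟨H, hH, h⟩ := exists_hoffman_const A
  refine ⟨H, hH, fun cap rate ⟨z, hz⟩ f hf r hr hres => ?_⟩
  let b : E ⊕ (E × V) ⊕ (V × V) → ℝ := fun s => match s with
    | .inl e => cap e
    | .inr (.inl _) => 0
    | .inr (.inr q) => if q.1 = q.2 then 0 else -rate q.1 q.2
  have hA : ∀ i k, i ≠ k → ∀ x : E × V → ℝ, A (.inr (.inr (i, k))) x =
      inflow E (fun e => x (e, k)) i - outflow E (fun e => x (e, k)) i := by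
    intro i k hik x
    simp [A, hik, inflow, outflow, LinearMap.sum_apply]
  have hb : ∀ i k, i ≠ k → b (.inr (.inr (i, k))) = -rate i k := fun i k hik => by simp [b, hik]
  obtain ⟨y, hy, hyf⟩ := h b (fun q => z q.1 q.2)
    (by
      rintro (e | ⟨e, k⟩ | ⟨i, k⟩)
      · simpa [A, b, LinearMap.sum_apply] using hz.1.2 e
      · simpa [A, b] using hz.1.1 e k
      · by_cases hik : i = k
        · simp [A, b, hik]
        · rw [hA i k hik, hb i k hik]
          linarith [hz.2 i k hik])
    (fun q => f q.1 q.2) r hr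
    (by
      rintro (e | ⟨e, k⟩ | ⟨i, k⟩)
      · have := hf.2 e
        simp only [A, b, LinearMap.sum_apply, LinearMap.proj_apply]
        linarith
      · have := hf.1 e k
        simp only [A, b, LinearMap.neg_apply, LinearMap.proj_apply]
        linarith
      · by_cases hik : i = k
        · simpa [A, b, hik] using hr
        · rw [hA i k hik, hb i k hik]
          linarith [hres i k hik])
  refine ⟨fun e k => y (e, k), ⟨⟨fun e k => ?_, fun e => ?_⟩, fun i k hik => ?_⟩,
    fun e k => hyf (e, k)⟩
  · simpa [A, b] using hy (.inr (.inl (e, k)))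
  · simpa [A, b, LinearMap.sum_apply] using hy (.inl e)
  · have := hy (.inr (.inr (i, k)))
    rw [hA i k hik, hb i k hik] at this
    linarith

section LowerBound

variable {P : Measure Ω} [IsProbabilityMeasure P] {ℱ : Filtration ℕ mΩ} {rate : V → V → ℝ}
  {η : ℕ → E → Ω → ℝ} {σ : NNReal}

/-- Conservation of packets in expectation. -/
theorem integral_backlog (hM : IsModel E P ℱ a rate η σ) (π : Policy E cap a) {T : ℕ}
    (hT : 1 ≤ T) {i k : V} (hik : i ≠ k) :
    ∫ ω, π.backlog T i k ω ∂P =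
      inflow E (fun e => ∑ t ∈ Finset.Ico 1 T, ∫ ω, π.actual t e k ω ∂P) i
      - outflow E (fun e => ∑ t ∈ Finset.Ico 1 T, ∫ ω, π.actual t e k ω ∂P) i
      + (T - 1) * rate i k := by
  induction T, hT using Nat.le_induction with
  | base => simp [π.backlog_one, inflow, outflow]
  | succ T hT ih =>
    have hin : Integrable (fun ω => inflow E (fun e => π.actual T e k ω) i) P :=
      integrable_finsetSum _ fun e _ => π.integrable_actual hT e k
    have hout : Integrable (fun ω => outflow E (fun e => π.actual T e k ω) i) P :=
      integrable_finsetSum _ fun e _ => π.integrable_actual hT e k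
    have hQ := π.integrable_backlog hM hT i k
    have hin' : ∫ ω, inflow E (fun e => π.actual T e k ω) i ∂P
        = inflow E (fun e => ∫ ω, π.actual T e k ω ∂P) i :=
      integral_finsetSum _ fun e _ => π.integrable_actual hT e k
    have hout' : ∫ ω, outflow E (fun e => π.actual T e k ω) i ∂P
        = outflow E (fun e => ∫ ω, π.actual T e k ω ∂P) i :=
      integral_finsetSum _ fun e _ => π.integrable_actual hT e k
    simp only [π.backlog_succ T hT i k hik]
    have hQo : Integrable (fun ω => π.backlog T i k ω
        - outflow E (fun e => π.actual T e k ω) i) P := hQ.sub hout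
    have hQoi : Integrable (fun ω => π.backlog T i k ω
        - outflow E (fun e => π.actual T e k ω) i
        + inflow E (fun e => π.actual T e k ω) i) P := hQo.add hin
    rw [integral_add hQoi (hM.integrable_arrival hT i k),
      integral_add hQo hin, integral_sub hQ hout, hin', hout', ih,
      hM.arrival_mean T hT i k]
    simp only [Finset.sum_Ico_succ_top hT, inflow, outflow, Finset.sum_add_distrib]
    push_cast
    ring

/-- The static benchmark bounds the expected cost of every policy from below. The time-averaged
expected transmissions of a policy fail to support the arrival rates by no more than `1 / T` times
its terminal backlog plus the total arrival rate, so they can be repaired at a cost that the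
terminal backlog cost covers up to a constant. -/
theorem exists_static_cost_le (E : Finset (V × V)) (c : E → ℝ) (hc : ∀ e, 0 ≤ c e) :
    ∃ C_L : ℝ, 0 ≤ C_L ∧ ∀ cB : ℝ, C_L ≤ cB → ∀ (cap : E → ℝ) (rate : V → V → ℝ),
      (∃ m, Supports cap rate m) →
      ∀ {Ω : Type*} [mΩ : MeasurableSpace Ω] (P : Measure Ω) [IsProbabilityMeasure P]
        (ℱ : Filtration ℕ mΩ) (a : ℕ → V → V → Ω → ℝ) (η : ℕ → E → Ω → ℝ) (σ : NNReal),
        IsModel E P ℱ a rate η σ → ∀ (π : Policy E cap a) (T : ℕ), 1 ≤ T →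
      ∃ m, Supports cap rate m ∧ (T : ℝ) * ∑ e, ∑ k, m e k * c e ≤
        ∫ ω, totalCost c cB T π ω ∂P + C_L * ∑ i, ∑ k, rate i k := by
  obtain ⟨H, hH, hrep⟩ := exists_flow_repair_const E
  have hcs : 0 ≤ ∑ e, ∑ _k : V, c e :=
    Finset.sum_nonneg fun e _ => Finset.sum_nonneg fun k _ => hc e
  refine ⟨H * ∑ e, ∑ _k : V, c e, by positivity, ?_⟩
  intro cB hcB cap rate hsup Ω mΩ P _ ℱ a η σ hM π T hT
  have hT0 : (0 : ℝ) < T := by exact_mod_cast hT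
  set F : E → V → ℝ := fun e k => ∑ t ∈ Finset.Ico 1 T, ∫ ω, π.actual t e k ω ∂P with hF
  set R : ℝ := ∑ i, ∑ k, ∫ ω, π.backlog T i k ω ∂P + ∑ i, ∑ k, rate i k with hR
  have hQ0 : ∀ i k, 0 ≤ ∫ ω, π.backlog T i k ω ∂P := fun i k =>
    integral_nonneg fun ω => π.backlog_nonneg hT i k ω
  have hR1 : ∀ i k, ∫ ω, π.backlog T i k ω ∂P + rate i k ≤ R := by
    intro i k
    rw [hR]
    gcongr
    · exact (Finset.single_le_sum (f := fun k => ∫ ω, π.backlog T i k ω ∂P)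
        (fun k _ => hQ0 i k) (Finset.mem_univ k)).trans
        (Finset.single_le_sum (f := fun i => ∑ k, ∫ ω, π.backlog T i k ω ∂P)
          (fun i _ => Finset.sum_nonneg fun k _ => hQ0 i k) (Finset.mem_univ i))
    · exact (Finset.single_le_sum (f := fun k => rate i k)
        (fun k _ => hM.rate_nonneg i k) (Finset.mem_univ k)).trans
        (Finset.single_le_sum (f := fun i => ∑ k, rate i k)
          (fun i _ => Finset.sum_nonneg fun k _ => hM.rate_nonneg i k) (Finset.mem_univ i))
  have hR0 : 0 ≤ R := add_nonneg
    (Finset.sum_nonneg fun i _ => Finset.sum_nonneg fun k _ => hQ0 i k)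
    (Finset.sum_nonneg fun i _ => Finset.sum_nonneg fun k _ => hM.rate_nonneg i k)
  have hcap : ∀ e, 0 ≤ cap e := fun e => by
    obtain ⟨m, hm⟩ := hsup
    exact cap_nonneg hm.1 e
  have hfeas : (fun e k => F e k / T) ∈ feasibleSet E cap := by
    constructor
    · intro e k
      refine div_nonneg (Finset.sum_nonneg fun t ht => integral_nonneg fun ω => ?_) hT0.le
      exact π.actual_nonneg t (Finset.mem_Ico.1 ht).1 e k ω
    · intro e
      rw [← Finset.sum_div, div_le_iff₀ hT0, Finset.sum_comm]
      calc ∑ t ∈ Finset.Ico 1 T, ∑ k, ∫ ω, π.actual t e k ω ∂P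
          ≤ ∑ t ∈ Finset.Ico 1 T, cap e := by
            refine Finset.sum_le_sum fun t ht => ?_
            have ht1 := (Finset.mem_Ico.1 ht).1
            rw [← integral_finsetSum _ fun k _ => π.integrable_actual ht1 e k]
            calc ∫ ω, ∑ k, π.actual t e k ω ∂P ≤ ∫ _ω, cap e ∂P :=
                  integral_mono (integrable_finsetSum _ fun k _ => π.integrable_actual ht1 e k)
                    (integrable_const _) fun ω => (π.actual_mem_feasibleSet ht1 ω).2 e
              _ = cap e := by simp
        _ = ((T - 1 : ℕ) : ℝ) * cap e := by simp
        _ ≤ cap e * T := by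
            rw [mul_comm]
            exact mul_le_mul_of_nonneg_left (by exact_mod_cast Nat.sub_le T 1) (hcap e)
  obtain ⟨m, hm, hmf⟩ := hrep cap rate hsup _ hfeas (R / T) (by positivity) (by
    intro i k hik
    have h1 := integral_backlog hM π hT hik
    have h2 := hR1 i k
    have h3 : inflow E (fun e => F e k / T) i = inflow E (fun e => F e k) i / T := by
      simp only [inflow, Finset.sum_div]
    have h4 : outflow E (fun e => F e k / T) i = outflow E (fun e => F e k) i / T := by
      simp only [outflow, Finset.sum_div]
    rw [h3, h4, ← sub_nonneg]
    have h5 : outflow E (fun e => F e k) i / T + R / T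
        - (inflow E (fun e => F e k) i / T + rate i k)
        = (outflow E (fun e => F e k) i + R - inflow E (fun e => F e k) i - T * rate i k) / T := by
      field_simp
      ring
    rw [h5]
    refine div_nonneg ?_ hT0.le
    linarith)
  refine ⟨m, hm, ?_⟩
  rw [(integral_totalCost hM π c cB hT).2]
  have hmF : ∀ e k, T * (m e k * c e) ≤ F e k * c e + H * R * c e := by
    intro e k
    have h1 := (abs_le.1 (hmf e k)).2
    have h2 : T * m e k ≤ F e k + H * R := by
      have h3 := mul_le_mul_of_nonneg_left h1 hT0.le
      have h4 : (T : ℝ) * (F e k / T) = F e k := by field_simp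
      have h5 : (T : ℝ) * (H * (R / T)) = H * R := by field_simp
      linarith
    nlinarith [mul_le_mul_of_nonneg_right h2 (hc e)]
  have hFc : ∑ e, ∑ k, F e k * c e ≤ ∑ t ∈ Finset.Icc 1 T, ∑ e, ∑ k,
      (∫ ω, π.actual t e k ω ∂P + ∫ ω, π.dummy t e k ω ∂P) * c e := by
    have hterm : ∀ t ∈ Finset.Icc 1 T, ∀ e k, 0 ≤ (∫ ω, π.actual t e k ω ∂P) * c e ∧
        0 ≤ (∫ ω, π.dummy t e k ω ∂P) * c e := fun t ht e k =>
      ⟨mul_nonneg (integral_nonneg fun ω => π.actual_nonneg t (Finset.mem_Icc.1 ht).1 e k ω)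
        (hc e), mul_nonneg (integral_nonneg fun ω =>
          π.dummy_nonneg t (Finset.mem_Icc.1 ht).1 e k ω) (hc e)⟩
    calc ∑ e, ∑ k, F e k * c e
        = ∑ t ∈ Finset.Ico 1 T, ∑ e, ∑ k, (∫ ω, π.actual t e k ω ∂P) * c e := by
          simp only [hF, Finset.sum_mul]
          symm
          rw [Finset.sum_comm]
          exact Finset.sum_congr rfl fun e _ => Finset.sum_comm
      _ ≤ ∑ t ∈ Finset.Icc 1 T, ∑ e, ∑ k, (∫ ω, π.actual t e k ω ∂P) * c e :=
          Finset.sum_le_sum_of_subset_of_nonneg Finset.Ico_subset_Icc_self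
            fun t ht _ => Finset.sum_nonneg fun e _ => Finset.sum_nonneg fun k _ =>
              (hterm t ht e k).1
      _ ≤ _ := Finset.sum_le_sum fun t ht => Finset.sum_le_sum fun e _ =>
          Finset.sum_le_sum fun k _ => by
            rw [add_mul]
            linarith [(hterm t ht e k).2]
  have hsum : (T : ℝ) * ∑ e, ∑ k, m e k * c e
      ≤ ∑ e, ∑ k, F e k * c e + H * R * ∑ e, ∑ _k : V, c e := by
    simp only [Finset.mul_sum, ← Finset.sum_add_distrib]
    exact Finset.sum_le_sum fun e _ => Finset.sum_le_sum fun k _ => by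
      simpa using hmF e k
  have hQs : 0 ≤ ∑ i, ∑ k, ∫ ω, π.backlog T i k ω ∂P :=
    Finset.sum_nonneg fun i _ => Finset.sum_nonneg fun k _ => hQ0 i k
  have hcBQ := mul_le_mul_of_nonneg_right hcB hQs
  have : H * R * ∑ e, ∑ _k : V, c e = (H * ∑ e, ∑ _k : V, c e) *
      ∑ i, ∑ k, ∫ ω, π.backlog T i k ω ∂P + (H * ∑ e, ∑ _k : V, c e) * ∑ i, ∑ k, rate i k := by
    rw [hR]; ring
  linarith

end LowerBound

end

section

/-! ### Independence of past and present -/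

section Model

variable {V : Type*} {Ω : Type*} [mΩ : MeasurableSpace Ω]
  {E : Finset (V × V)} {a : ℕ → V → V → Ω → ℝ} {P : Measure Ω} {ℱ : Filtration ℕ mΩ}
  {rate : V → V → ℝ} {η : ℕ → E → Ω → ℝ} {σ : NNReal}

theorem IsModel.indepFun_arrival (hM : IsModel E P ℱ a rate η σ) (t : ℕ) (i k : V) {X : Ω → ℝ}
    (hX : Measurable[ℱ t] X) : IndepFun X (a t i k) P := by
  have hle : MeasurableSpace.comap (a t i k) inferInstance ≤ MeasurableSpace.comap
      (fun ω => ((fun i k => a t i k ω, fun e => η t e ω) : (V → V → ℝ) × (E → ℝ)))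
      inferInstance := by
    have : a t i k = (fun p : (V → V → ℝ) × (E → ℝ) => p.1 i k) ∘
      (fun ω => ((fun i k => a t i k ω, fun e => η t e ω) : (V → V → ℝ) × (E → ℝ))) := rfl
    rw [this, ← MeasurableSpace.comap_comp]
    exact MeasurableSpace.comap_mono (Measurable.comap_le (by fun_prop))
  exact (indep_of_indep_of_le_right (indep_of_indep_of_le_left (hM.indep t) hle) hX.comap_le).symm

theorem IsModel.indepFun_noise (hM : IsModel E P ℱ a rate η σ) (t : ℕ) (e : E) {X : Ω → ℝ}
    (hX : Measurable[ℱ t] X) : IndepFun X (η t e) P := by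
  have hle : MeasurableSpace.comap (η t e) inferInstance ≤ MeasurableSpace.comap
      (fun ω => ((fun i k => a t i k ω, fun e => η t e ω) : (V → V → ℝ) × (E → ℝ)))
      inferInstance := by
    have : η t e = (fun p : (V → V → ℝ) × (E → ℝ) => p.2 e) ∘
      (fun ω => ((fun i k => a t i k ω, fun e => η t e ω) : (V → V → ℝ) × (E → ℝ))) := rfl
    rw [this, ← MeasurableSpace.comap_comp]
    exact MeasurableSpace.comap_mono (Measurable.comap_le (by fun_prop))
  exact (indep_of_indep_of_le_right (indep_of_indep_of_le_left (hM.indep t) hle) hX.comap_le).symm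

theorem IsModel.integral_mul_arrival_sub_rate [IsProbabilityMeasure P]
    (hM : IsModel E P ℱ a rate η σ) {t : ℕ} (ht : 1 ≤ t) (i k : V) {X : Ω → ℝ}
    (hX : Measurable[ℱ t] X) : ∫ ω, X ω * (a t i k ω - rate i k) ∂P = 0 := by
  have hind : IndepFun X (fun ω => a t i k ω - rate i k) P :=
    (hM.indepFun_arrival t i k hX).comp measurable_id (measurable_id.sub_const (rate i k))
  rw [hind.integral_fun_mul_eq_mul_integral (hX.mono (ℱ.le t) le_rfl).aestronglyMeasurable
    ((hM.measurable_arrival ht i k).sub_const _).aestronglyMeasurable,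
    integral_sub (hM.integrable_arrival ht i k) (integrable_const _), hM.arrival_mean t ht i k]
  simp

end Model

/-! ### Concentration of the cost estimates -/

variable {V : Type*} [Fintype V] [DecidableEq V] {Ω : Type*} [mΩ : MeasurableSpace Ω]
  {E : Finset (V × V)} {cap : E → ℝ} {a : ℕ → V → V → Ω → ℝ}

section Observations

theorem observed_zero (π : Policy E cap a) (e : E) (ω : Ω) : observed π 0 e ω = 1 := by
  simp [observed]

theorem observed_eq_zero_or_one (π : Policy E cap a) (t : ℕ) (e : E) (ω : Ω) :
    observed π t e ω = 0 ∨ observed π t e ω = 1 := by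
  unfold observed
  split_ifs
  · exact Or.inr rfl
  · exact Or.inl rfl

theorem observed_nonneg (π : Policy E cap a) (t : ℕ) (e : E) (ω : Ω) : 0 ≤ observed π t e ω := by
  rcases observed_eq_zero_or_one π t e ω with h | h <;> simp [h]

theorem observed_le_one (π : Policy E cap a) (t : ℕ) (e : E) (ω : Ω) : observed π t e ω ≤ 1 := by
  rcases observed_eq_zero_or_one π t e ω with h | h <;> simp [h]

/-- Transmissions occur on observed edges only. -/
theorem planned_mul_observed (π : Policy E cap a) {t : ℕ} (ht : 1 ≤ t) (e : E) (k : V) (ω : Ω) :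
    π.planned t e k ω * observed π t e ω = π.planned t e k ω := by
  unfold observed
  split_ifs with h
  · rw [mul_one]
  · push Not at h
    have := (π.planned_feasible t ht ω).1 e k
    rw [le_antisymm (h.2 k) this, zero_mul]

theorem obsCount_succ (π : Policy E cap a) (t : ℕ) (e : E) (ω : Ω) :
    obsCount π (t + 1) e ω = obsCount π t e ω + observed π t e ω :=
  Finset.sum_range_succ _ _

theorem obsCount_one (π : Policy E cap a) (e : E) (ω : Ω) : obsCount π 1 e ω = 1 := by
  simp [obsCount, observed_zero]

theorem exists_obsCount_eq (π : Policy E cap a) {t : ℕ} (ht : 1 ≤ t) (e : E) (ω : Ω) :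
    ∃ n : ℕ, 1 ≤ n ∧ n ≤ t ∧ obsCount π t e ω = n := by
  induction t, ht using Nat.le_induction with
  | base => exact ⟨1, le_rfl, le_rfl, by simp [obsCount_one]⟩
  | succ t ht ih =>
    obtain ⟨n, h1, hn, h⟩ := ih
    rcases observed_eq_zero_or_one π t e ω with ho | ho
    · exact ⟨n, h1, by omega, by rw [obsCount_succ, ho, h, add_zero]⟩
    · exact ⟨n + 1, by omega, by omega, by rw [obsCount_succ, ho, h]; push_cast; ring⟩

theorem one_le_obsCount (π : Policy E cap a) {t : ℕ} (ht : 1 ≤ t) (e : E) (ω : Ω) :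
    1 ≤ obsCount π t e ω := by
  obtain ⟨n, h1, -, h⟩ := exists_obsCount_eq π ht e ω
  rw [h]; exact_mod_cast h1

theorem obsCount_le (π : Policy E cap a) {t : ℕ} (ht : 1 ≤ t) (e : E) (ω : Ω) :
    obsCount π t e ω ≤ t := by
  obtain ⟨n, -, h1, h⟩ := exists_obsCount_eq π ht e ω
  rw [h]; exact_mod_cast h1

theorem sum_observed_div_sqrt_le (π : Policy E cap a) (T : ℕ) (e : E) (ω : Ω) :
    ∑ t ∈ Finset.Icc 1 T, observed π t e ω / √(obsCount π t e ω) ≤ 3 * √(T + 1) := by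
  have key : ∑ t ∈ Finset.Icc 1 T, observed π t e ω / √(obsCount π t e ω)
      ≤ 3 * √(obsCount π (T + 1) e ω) := by
    induction T with
    | zero => simp
    | succ T ih =>
      rw [Finset.sum_Icc_succ_top (by omega)]
      have h1 := one_le_obsCount π (t := T + 1) (by omega) e ω
      rw [obsCount_succ π (T + 1)]
      set N := obsCount π (T + 1) e ω
      have hN : 0 < √N := Real.sqrt_pos.2 (by linarith)
      rcases observed_eq_zero_or_one π (T + 1) e ω with ho | ho
      · rw [ho]; simpa using ih
      · rw [ho]
        -- `√(N + 1) - √N = 1 / (√(N + 1) + √N)` and `N + 1 ≤ 4 * N`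
        have h2 : √(N + 1) ≤ 2 * √N := by
          rw [Real.sqrt_le_left (by positivity), mul_pow, Real.sq_sqrt (by linarith)]
          linarith
        have h3 : √(N + 1) ^ 2 = N + 1 := Real.sq_sqrt (by linarith)
        have h4 : √N ^ 2 = N := Real.sq_sqrt (by linarith)
        have h5 : √N ≤ √(N + 1) := Real.sqrt_le_sqrt (by linarith)
        have h6 : 1 / √N ≤ 3 * (√(N + 1) - √N) := by
          rw [div_le_iff₀ hN]
          nlinarith
        linarith
  refine key.trans ?_
  have := obsCount_le π (t := T + 1) (by omega) e ω
  push_cast at this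
  gcongr

end Observations

/-- Sum of the noise in the observations of edge `e` before slot `t`. -/
noncomputable def noiseSum (η : ℕ → E → Ω → ℝ) (π : Policy E cap a) (t : ℕ) (e : E) (ω : Ω) : ℝ :=
  ∑ τ ∈ Finset.range t, η τ e ω * observed π τ e ω

theorem costEstimate_eq (c : E → ℝ) (η : ℕ → E → Ω → ℝ) (β δ : ℝ) (π : Policy E cap a) {t : ℕ}
    (ht : 1 ≤ t) (hlog : 0 ≤ β * Real.log (t / δ)) (e : E) (ω : Ω) :
    costEstimate c η β δ π t e ω = c e + noiseSum η π t e ω / obsCount π t e ω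
      - √(β * Real.log (t / δ)) / √(obsCount π t e ω) := by
  have hN : obsCount π t e ω ≠ 0 := by linarith [one_le_obsCount π ht e ω]
  have h : ∑ τ ∈ Finset.range t, (c e + η τ e ω) * observed π τ e ω
      = c e * obsCount π t e ω + noiseSum η π t e ω := by
    simp only [obsCount, noiseSum, add_mul, Finset.sum_add_distrib, Finset.mul_sum]
  rw [costEstimate, avgCost, h, Real.sqrt_div hlog, add_div, mul_div_cancel_right₀ _ hN]

section Concentration

variable {P : Measure Ω} {ℱ : Filtration ℕ mΩ} {rate : V → V → ℝ}
  {η : ℕ → E → Ω → ℝ} {σ : NNReal} {c : E → ℝ} {β δ ν : ℝ} {T : ℕ} {π : Policy E cap a}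

theorem IsDPOP.measurable_observed (hD : IsDPOP ℱ c η β δ ν T π) {t : ℕ} (ht : t ≤ T) (e : E) :
    Measurable[ℱ t] (observed π t e) := by
  rcases Nat.eq_zero_or_pos t with rfl | h1
  · have : observed π 0 e = fun _ => 1 := funext fun ω => observed_zero π e ω
    rw [this]
    exact measurable_const
  · unfold observed
    refine Measurable.ite ?_ measurable_const measurable_const
    have : {ω | t = 0 ∨ ∃ k, 0 < π.planned t e k ω} = ⋃ k, {ω | 0 < π.planned t e k ω} := by
      ext ω
      simp [h1.ne']
    rw [this]
    exact MeasurableSet.iUnion fun k =>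
      measurableSet_lt measurable_const (hD.planned_adapted t h1 ht e k)

theorem IsDPOP.measurable_obsCount (hD : IsDPOP ℱ c η β δ ν T π) {t : ℕ} (ht : t ≤ T + 1)
    (e : E) : Measurable[ℱ t] (obsCount π t e) := by
  refine Finset.measurable_fun_sum _ fun τ hτ => ?_
  have := Finset.mem_range.1 hτ
  exact (hD.measurable_observed (by omega) e).mono (ℱ.mono this.le) le_rfl

theorem IsDPOP.measurable_noiseSum (hM : IsModel E P ℱ a rate η σ)
    (hD : IsDPOP ℱ c η β δ ν T π) {t : ℕ} (ht : t ≤ T + 1) (e : E) :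
    Measurable[ℱ t] (noiseSum η π t e) := by
  refine Finset.measurable_fun_sum _ fun τ hτ => ?_
  have := Finset.mem_range.1 hτ
  exact ((hM.noise_adapted τ e).mono (ℱ.mono this) le_rfl).mul
    ((hD.measurable_observed (by omega) e).mono (ℱ.mono this.le) le_rfl)

variable [IsProbabilityMeasure P]

/-- The exponential supermartingale of the observed noise. -/
theorem integral_exp_noiseSum_le (hM : IsModel E P ℱ a rate η σ) (hD : IsDPOP ℱ c η β δ ν T π)
    (l : ℝ) (e : E) {t : ℕ} (ht : t ≤ T + 1) :
    Integrable (fun ω => Real.exp (l * noiseSum η π t e ω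
      - l ^ 2 * (σ : ℝ) ^ 2 / 2 * obsCount π t e ω)) P ∧
    ∫ ω, Real.exp (l * noiseSum η π t e ω
      - l ^ 2 * (σ : ℝ) ^ 2 / 2 * obsCount π t e ω) ∂P ≤ 1 := by
  induction t with
  | zero => simp [noiseSum, obsCount]
  | succ t ih =>
    obtain ⟨hint, hle⟩ := ih (by omega)
    set G : Ω → ℝ := fun ω => Real.exp (l * noiseSum η π t e ω
      - l ^ 2 * (σ : ℝ) ^ 2 / 2 * obsCount π t e ω) with hG
    set o : Ω → ℝ := observed π t e with ho
    set F : Ω → ℝ := fun ω => Real.exp (l * η t e ω - l ^ 2 * (σ : ℝ) ^ 2 / 2) with hF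
    have ho_meas : Measurable[ℱ t] o := hD.measurable_observed (by omega) e
    have hG_meas : Measurable[ℱ t] G := by
      have h1 := hD.measurable_obsCount (t := t) (by omega) e
      have h2 := hD.measurable_noiseSum hM (t := t) (by omega) e
      exact Real.measurable_exp.comp ((h2.const_mul l).sub (h1.const_mul _))
    have hstep : (fun ω => Real.exp (l * noiseSum η π (t + 1) e ω
        - l ^ 2 * (σ : ℝ) ^ 2 / 2 * obsCount π (t + 1) e ω))
        = fun ω => (G ω - G ω * o ω) + (G ω * o ω) * F ω := by
      funext ω
      have h1 : noiseSum η π (t + 1) e ω = noiseSum η π t e ω + η t e ω * o ω :=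
        Finset.sum_range_succ _ _
      rw [h1, obsCount_succ]
      rcases observed_eq_zero_or_one π t e ω with h | h
      · simp [ho, hG, h]
      · simp only [ho, hG, hF, h, ← Real.exp_add, mul_one, sub_self, zero_add]
        congr 1
        ring
    have hGo : Integrable (fun ω => G ω * o ω) P := by
      refine hint.mono ((hG_meas.mul ho_meas).mono (ℱ.le t) le_rfl).aestronglyMeasurable
        (ae_of_all _ fun ω => ?_)
      rw [norm_mul, Real.norm_of_nonneg (observed_nonneg π t e ω)]
      exact mul_le_of_le_one_right (norm_nonneg _) (observed_le_one π t e ω)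
    have hFeq : F = fun ω => Real.exp (l * η t e ω) * Real.exp (-(l ^ 2 * (σ : ℝ) ^ 2 / 2)) := by
      funext ω
      rw [hF, ← Real.exp_add]
      congr 1
    have hFint : Integrable F P := by
      rw [hFeq]
      exact ((hM.noise_subgaussian t e).integrable_exp_mul l).mul_const _
    have hFle : ∫ ω, F ω ∂P ≤ 1 := by
      rw [hFeq, integral_mul_const]
      have h := (hM.noise_subgaussian t e).mgf_le l
      rw [mgf] at h
      calc (∫ ω, Real.exp (l * η t e ω) ∂P) * Real.exp (-(l ^ 2 * (σ : ℝ) ^ 2 / 2))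
          ≤ Real.exp (((σ ^ 2 : NNReal) : ℝ) * l ^ 2 / 2)
            * Real.exp (-(l ^ 2 * (σ : ℝ) ^ 2 / 2)) := by gcongr
        _ = 1 := by
          rw [← Real.exp_add]
          push_cast
          rw [show (σ : ℝ) ^ 2 * l ^ 2 / 2 + -(l ^ 2 * (σ : ℝ) ^ 2 / 2) = 0 by ring, Real.exp_zero]
    have hind : IndepFun (fun ω => G ω * o ω) F P :=
      (hM.indepFun_noise t e (hG_meas.mul ho_meas)).comp measurable_id
        (φ := fun x => x) (ψ := fun x => Real.exp (l * x - l ^ 2 * (σ : ℝ) ^ 2 / 2))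
        (by fun_prop)
    have hGoF : Integrable (fun ω => (G ω * o ω) * F ω) P := hind.integrable_mul hGo hFint
    have hG_sub : Integrable (fun ω => G ω - G ω * o ω) P := hint.sub hGo
    rw [hstep]
    refine ⟨hG_sub.add hGoF, ?_⟩
    rw [integral_add hG_sub hGoF, integral_sub hint hGo,
      hind.integral_fun_mul_eq_mul_integral hGo.aestronglyMeasurable hFint.aestronglyMeasurable]
    have h0 : 0 ≤ ∫ ω, G ω * o ω ∂P :=
      integral_nonneg fun ω => mul_nonneg (Real.exp_pos _).le (observed_nonneg π t e ω)
    nlinarith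

/-- Sizes of the confidence radius for the parameter `δ` of horizon `T`. -/
theorem radius_bounds {σ β : ℝ} (hσ : 0 < σ) (hβ : 4 * σ ^ 2 < β) {T : ℕ} (hT : 3 ≤ T) {t : ℕ}
    (ht : 1 ≤ t) (htT : t ≤ T) {y : ℝ}
    (hy : y = β * Real.log (t / (T : ℝ) ^ (-(2 * σ ^ 2 / β)))) :
    σ ^ 2 ≤ y ∧ y ≤ 2 * β * Real.log T ∧ Real.exp (-(y / (2 * σ ^ 2))) ≤ 1 / (t * T) := by
  have hT0 : (0 : ℝ) < T := by exact_mod_cast (by omega : 0 < T)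
  have ht0 : (0 : ℝ) < t := by exact_mod_cast ht
  have hσ2 : 0 < σ ^ 2 := by positivity
  have hβ0 : 0 < β := by linarith
  have hy' : y = β * Real.log t + 2 * σ ^ 2 * Real.log T := by
    rw [hy, Real.log_div ht0.ne' (Real.rpow_pos_of_pos hT0 _).ne', Real.log_rpow hT0]
    field_simp
    ring
  have hlt : 0 ≤ Real.log t := Real.log_nonneg (by exact_mod_cast ht)
  have hltT : Real.log t ≤ Real.log T := Real.log_le_log ht0 (by exact_mod_cast htT)
  have hlT : 1 ≤ Real.log T := by
    rw [Real.le_log_iff_exp_le hT0]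
    have : (3 : ℝ) ≤ T := by exact_mod_cast hT
    linarith [Real.exp_one_lt_d9]
  refine ⟨?_, ?_, ?_⟩
  · rw [hy']; nlinarith [mul_nonneg hβ0.le hlt]
  · rw [hy']; nlinarith
  · have h : Real.log t + Real.log T ≤ y / (2 * σ ^ 2) := by
      rw [le_div_iff₀ (by positivity), hy']
      nlinarith
    calc Real.exp (-(y / (2 * σ ^ 2))) ≤ Real.exp (-(Real.log t + Real.log T)) := by gcongr
      _ = 1 / (t * T) := by
        rw [← Real.log_mul ht0.ne' hT0.ne', Real.exp_neg, Real.exp_log (by positivity), one_div]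

/-- The excess of the self-normalized noise over a threshold `y` is bounded by exponentials. On
`{N = n}` the exponential with parameter `y / (σ² √n)` is the one that is needed. -/
theorem excess_le_exp {σ y M : ℝ} (hσ : 0 < σ) (hy : 0 < y) {n : ℕ} (hn : 1 ≤ n) :
    M / √n - y ≤ σ ^ 2 / y * Real.exp (-(y ^ 2 / (2 * σ ^ 2))) *
      Real.exp (y / (σ ^ 2 * √n) * M - (y / (σ ^ 2 * √n)) ^ 2 * σ ^ 2 / 2 * n) := by
  have hn0 : (0 : ℝ) < n := by exact_mod_cast hn
  have hs : 0 < √(n : ℝ) := Real.sqrt_pos.2 hn0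
  have hs2 : √(n : ℝ) ^ 2 = n := Real.sq_sqrt hn0.le
  have hexp : -(y ^ 2 / (2 * σ ^ 2)) +
      (y / (σ ^ 2 * √n) * M - (y / (σ ^ 2 * √n)) ^ 2 * σ ^ 2 / 2 * n)
      = y / σ ^ 2 * (M / √n - y) := by
    rw [← hs2, Real.sqrt_sq hs.le]
    field_simp
    ring
  rw [mul_assoc, ← Real.exp_add, hexp]
  have h := Real.add_one_le_exp (y / σ ^ 2 * (M / √n - y))
  calc M / √n - y = σ ^ 2 / y * (y / σ ^ 2 * (M / √n - y)) := by field_simp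
    _ ≤ _ := by gcongr; linarith

/-- The estimation errors are controlled by confidence radii up to variables `D` with small mean. -/
theorem exists_deviation_bound (hM : IsModel E P ℱ a rate η σ) (hσ : 0 < σ)
    (hβ : 4 * (σ : ℝ) ^ 2 < β) (hT : 3 ≤ T)
    (hD : IsDPOP ℱ c η β ((T : ℝ) ^ (-(2 * (σ : ℝ) ^ 2 / β))) ν T π) (e : E) {t : ℕ}
    (ht : 1 ≤ t) (htT : t ≤ T) :
    ∃ D : Ω → ℝ, Integrable D P ∧ ∫ ω, D ω ∂P ≤ 2 * σ / T ∧ ∀ ω, 0 ≤ D ω ∧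
      costEstimate c η β ((T : ℝ) ^ (-(2 * (σ : ℝ) ^ 2 / β))) π t e ω - c e ≤ D ω ∧
      c e - costEstimate c η β ((T : ℝ) ^ (-(2 * (σ : ℝ) ^ 2 / β))) π t e ω
        ≤ 2 * √(2 * β * Real.log T) / √(obsCount π t e ω) + D ω := by
  have hσ' : (0 : ℝ) < σ := by exact_mod_cast hσ
  have hT0 : (0 : ℝ) < T := by exact_mod_cast (by omega : 0 < T)
  have ht0 : (0 : ℝ) < t := by exact_mod_cast ht
  obtain ⟨hy1, hy2, hy3⟩ := radius_bounds hσ' hβ hT ht htT rfl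
  set δ := (T : ℝ) ^ (-(2 * (σ : ℝ) ^ 2 / β))
  set y : ℝ := √(β * Real.log (t / δ)) with hy
  have hlog : 0 ≤ β * Real.log (t / δ) := (sq_nonneg _).trans hy1
  have hyσ : (σ : ℝ) ≤ y := Real.le_sqrt_of_sq_le hy1
  have hy0 : 0 < y := hσ'.trans_le hyσ
  have hysq : y ^ 2 = β * Real.log (t / δ) := Real.sq_sqrt hlog
  have hyY : y ≤ √(2 * β * Real.log T) := Real.sqrt_le_sqrt hy2
  set l : ℕ → ℝ := fun n => y / ((σ : ℝ) ^ 2 * √n) with hl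
  set G : ℝ → Ω → ℝ := fun l ω => Real.exp (l * noiseSum η π t e ω
      - l ^ 2 * (σ : ℝ) ^ 2 / 2 * obsCount π t e ω) with hG
  have hGint : ∀ l, Integrable (G l) P ∧ ∫ ω, G l ω ∂P ≤ 1 := fun l =>
    integral_exp_noiseSum_le hM hD l e (by omega)
  have hGpos : ∀ l ω, 0 ≤ G l ω := fun l ω => (Real.exp_pos _).le
  set C : ℝ := (σ : ℝ) ^ 2 / y * Real.exp (-(y ^ 2 / (2 * (σ : ℝ) ^ 2))) with hC
  have hC0 : 0 ≤ C := by positivity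
  have hsumint : ∀ n ∈ Finset.Icc 1 t, Integrable (fun ω => G (l n) ω + G (-l n) ω) P :=
    fun n _ => (hGint _).1.add (hGint _).1
  set D : Ω → ℝ := fun ω => C * ∑ n ∈ Finset.Icc 1 t, (G (l n) ω + G (-l n) ω) with hDdef
  have hdev : ∀ ω, |noiseSum η π t e ω| / √(obsCount π t e ω) - y ≤ D ω := by
    intro ω
    obtain ⟨n, hn1, hnt, hn⟩ := exists_obsCount_eq π ht e ω
    have hmem : n ∈ Finset.Icc 1 t := Finset.mem_Icc.2 ⟨hn1, hnt⟩
    have hle : G (l n) ω + G (-l n) ω ≤ ∑ n ∈ Finset.Icc 1 t, (G (l n) ω + G (-l n) ω) :=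
      Finset.single_le_sum (f := fun n => G (l n) ω + G (-l n) ω)
        (fun n _ => add_nonneg (hGpos _ ω) (hGpos _ ω)) hmem
    have hle' := mul_le_mul_of_nonneg_left hle hC0
    rcases abs_cases (noiseSum η π t e ω) with ⟨h, -⟩ | ⟨h, -⟩
    · have h1 := excess_le_exp (M := noiseSum η π t e ω) hσ' hy0 hn1
      have h2 : C * G (l n) ω ≤ C * (G (l n) ω + G (-l n) ω) :=
        mul_le_mul_of_nonneg_left (by linarith [hGpos (-l n) ω]) hC0
      rw [h, hn]
      refine h1.trans (le_trans ?_ (h2.trans hle'))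
      simp only [hG, hl, hn, hC, le_refl]
    · have h1 := excess_le_exp (M := -noiseSum η π t e ω) hσ' hy0 hn1
      have h2 : C * G (-l n) ω ≤ C * (G (l n) ω + G (-l n) ω) :=
        mul_le_mul_of_nonneg_left (by linarith [hGpos (l n) ω]) hC0
      rw [h, hn]
      refine h1.trans (le_trans ?_ (h2.trans hle'))
      simp only [hG, hl, hn, hC, neg_sq, mul_neg, neg_mul, le_refl]
  have hD0 : ∀ ω, 0 ≤ D ω := fun ω => mul_nonneg hC0
    (Finset.sum_nonneg fun n _ => add_nonneg (hGpos _ ω) (hGpos _ ω))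
  refine ⟨D, (integrable_finsetSum _ hsumint).const_mul C, ?_, fun ω => ⟨hD0 ω, ?_⟩⟩
  · rw [hDdef, integral_const_mul, integral_finsetSum _ hsumint]
    have h1 : ∑ n ∈ Finset.Icc 1 t, ∫ ω, (G (l n) ω + G (-l n) ω) ∂P ≤ t * 2 := by
      calc _ ≤ ∑ n ∈ Finset.Icc 1 t, (2 : ℝ) := by
            refine Finset.sum_le_sum fun n _ => ?_
            rw [integral_add (hGint _).1 (hGint _).1]
            linarith [(hGint (l n)).2, (hGint (-l n)).2]
        _ = t * 2 := by simp
    have h2 : C ≤ σ * (1 / (t * T)) := by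
      rw [hC, hysq]
      refine mul_le_mul ?_ hy3 (Real.exp_pos _).le hσ'.le
      rw [div_le_iff₀ hy0]
      nlinarith
    calc C * ∑ n ∈ Finset.Icc 1 t, ∫ ω, (G (l n) ω + G (-l n) ω) ∂P
        ≤ C * (t * 2) := by gcongr
      _ ≤ σ * (1 / (t * T)) * (t * 2) := by gcongr
      _ = 2 * σ / T := by field_simp
  · rw [costEstimate_eq c η β δ π ht hlog]
    have hN1 := one_le_obsCount π ht e ω
    have hdevω := hdev ω
    set N := obsCount π t e ω
    set M := noiseSum η π t e ω
    have hsN : 1 ≤ √N := Real.one_le_sqrt.2 hN1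
    have hsN0 : 0 < √N := by linarith
    have hN : √N * √N = N := Real.mul_self_sqrt (by linarith)
    have hMN : |M| / N - y / √N ≤ D ω := by
      have h1 : |M| / N - y / √N = (|M| / √N - y) / √N := by
        rw [sub_div, div_div, hN]
      rw [h1, div_le_iff₀ hsN0]
      nlinarith [hD0 ω]
    have h1 : M / N ≤ |M| / N := by gcongr; exact le_abs_self M
    have h2 : -(M / N) ≤ |M| / N := by rw [← neg_div]; gcongr; exact neg_le_abs M
    have h3 : y / √N ≤ √(2 * β * Real.log T) / √N := by gcongr
    have h4 : 2 * √(2 * β * Real.log T) / √N = 2 * (√(2 * β * Real.log T) / √N) := by ring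
    constructor
    · linarith
    · rw [h4]; linarith

/-- If all noise so far is at most `x`, then the estimation error is at most `x` plus the largest
confidence radius. -/
theorem abs_costEstimate_sub_le (hσ : 0 < σ) (hβ : 4 * (σ : ℝ) ^ 2 < β) (hT : 3 ≤ T)
    (π : Policy E cap a) (c : E → ℝ) (e : E) {t : ℕ} (ht : 1 ≤ t) (htT : t ≤ T) {x : ℝ} {ω : Ω}
    (hx : ∀ τ < t, |η τ e ω| ≤ x) :
    |costEstimate c η β ((T : ℝ) ^ (-(2 * (σ : ℝ) ^ 2 / β))) π t e ω - c e|
      ≤ x + √(2 * β * Real.log T) := by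
  have hσ' : (0 : ℝ) < σ := by exact_mod_cast hσ
  obtain ⟨hy1, hy2, -⟩ := radius_bounds hσ' hβ hT ht htT rfl
  have hlog := (sq_nonneg (σ : ℝ)).trans hy1
  rw [costEstimate_eq c η β _ π ht hlog]
  have hyY := Real.sqrt_le_sqrt hy2
  have hN1 := one_le_obsCount π ht e ω
  have hM : |noiseSum η π t e ω| ≤ x * obsCount π t e ω := by
    rw [noiseSum, obsCount, Finset.mul_sum]
    refine (Finset.abs_sum_le_sum_abs _ _).trans (Finset.sum_le_sum fun τ hτ => ?_)
    rw [abs_mul, abs_of_nonneg (observed_nonneg π τ e ω)]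
    exact mul_le_mul_of_nonneg_right (hx τ (Finset.mem_range.1 hτ)) (observed_nonneg π τ e ω)
  set y : ℝ := √(β * Real.log (t / (T : ℝ) ^ (-(2 * (σ : ℝ) ^ 2 / β))))
  set N := obsCount π t e ω
  have hN0 : 0 < N := by linarith
  have h1 : |noiseSum η π t e ω / N| ≤ x := by
    rw [abs_div, abs_of_pos hN0, div_le_iff₀ hN0]
    exact hM
  have hy0 : 0 ≤ y := Real.sqrt_nonneg _
  have h2 : y / √N ≤ y := div_le_self hy0 (Real.one_le_sqrt.2 hN1)
  have h3 : 0 ≤ y / √N := by positivity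
  rw [abs_le] at h1 ⊢
  constructor <;> linarith

end Concentration

end

section

/-! ### Processes with negative drift -/

section Drift

variable {Ω : Type*} [MeasurableSpace Ω] {P : Measure Ω} [IsProbabilityMeasure P]

/-- One step of the exponential of a process that drifts downwards above the level `θ`. -/
theorem exp_step_le {z z' x D ζ θ r : ℝ} (hr : 0 ≤ r) (hrD : 2 * (r * D) ≤ 1) (hζ : 0 ≤ ζ)
    (hζD : ζ ≤ D) (hx : |x| ≤ D) (hz : z' ≤ z - ζ + x) :
    Real.exp (r * (z' - θ)) ≤
      Real.exp (r * (z - θ)) * (1 - r * ζ + 4 * (r * D) ^ 2 + r * x) := by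
  have hD : 0 ≤ D := hζ.trans hζD
  have hrD0 : 0 ≤ r * D := mul_nonneg hr hD
  have hu : |r * (x - ζ)| ≤ 2 * (r * D) := by
    rw [abs_mul, abs_of_nonneg hr]
    have : |x - ζ| ≤ 2 * D := by
      rw [abs_le] at hx ⊢
      constructor <;> linarith
    nlinarith
  have h1 := Real.abs_exp_sub_one_sub_id_le (hu.trans hrD)
  have h2 : (r * (x - ζ)) ^ 2 ≤ (2 * (r * D)) ^ 2 := sq_le_sq' (abs_le.1 hu).1 (abs_le.1 hu).2
  have h3 := (abs_le.1 h1).2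
  calc Real.exp (r * (z' - θ)) ≤ Real.exp (r * (z - θ) + r * (x - ζ)) := by
        refine Real.exp_le_exp.2 ?_
        nlinarith [mul_le_mul_of_nonneg_left hz hr]
    _ = Real.exp (r * (z - θ)) * Real.exp (r * (x - ζ)) := Real.exp_add _ _
    _ ≤ _ := by
        gcongr
        linarith

/-- A process with bounded upward jumps that, as long as the events `S t` hold, drifts downwards
above the level `θ` up to martingale differences `X t`, has a mean that exceeds `θ` by no more
than a constant and the contribution of the failure of `S T`. The constant does not depend on the
horizon `T`; this is shown with an exponential Lyapunov function. -/
theorem integral_le_of_drift {T : ℕ} (hT : 1 ≤ T) {Z X : ℕ → Ω → ℝ} {S : ℕ → Set Ω}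
    {D ζ θ : ℝ} (hζ : 0 < ζ) (hζD : ζ ≤ D) (hθ : 0 ≤ θ)
    (hZm : ∀ t, 1 ≤ t → t ≤ T → Measurable (Z t)) (hXm : ∀ t, 1 ≤ t → t < T → Measurable (X t))
    (hSm : ∀ t, 1 ≤ t → t ≤ T → MeasurableSet (S t))
    (hS : ∀ t, 1 ≤ t → t < T → S (t + 1) ⊆ S t)
    (hZ0 : ∀ t, 1 ≤ t → t ≤ T → ∀ ω, 0 ≤ Z t ω) (hZ1 : ∀ ω, Z 1 ω = 0)
    (hZD : ∀ t, 1 ≤ t → t < T → ∀ ω, Z (t + 1) ω ≤ Z t ω + D)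
    (hXD : ∀ t, 1 ≤ t → t < T → ∀ ω, |X t ω| ≤ D)
    (hdrift : ∀ t, 1 ≤ t → t < T → ∀ ω ∈ S t, θ ≤ Z t ω → Z (t + 1) ω ≤ Z t ω - ζ + X t ω)
    (hmart : ∀ t, 1 ≤ t → t < T → ∀ r : ℝ,
      ∫ ω, (S t ∩ {ω | θ ≤ Z t ω}).indicator (fun ω => Real.exp (r * (Z t ω - θ))) ω * X t ω ∂P
        = 0) :
    ∫ ω, Z T ω ∂P ≤ θ + 16 * D ^ 2 / ζ * (64 * D ^ 2 / ζ ^ 2 + 1) + T * D * P.real (S T)ᶜ := by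
  have hD : 0 < D := hζ.trans_le hζD
  have hZle : ∀ t, 1 ≤ t → t ≤ T → ∀ ω, Z t ω ≤ t * D := by
    intro t ht
    induction t, ht using Nat.le_induction with
    | base => intro _ ω; rw [hZ1]; positivity
    | succ t ht ih =>
      intro htT ω
      have h1 := ih (by omega) ω
      have h2 := hZD t ht (by omega) ω
      push_cast
      linarith
  set r : ℝ := ζ / (16 * D ^ 2) with hr
  have hr0 : 0 < r := by positivity
  have hrD : r * D = ζ / (16 * D) := by rw [hr]; field_simp
  have hrD16 : r * D ≤ 1 / 16 := by
    rw [hrD, div_le_div_iff₀ (by positivity) (by norm_num)]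
    linarith
  set κ : ℝ := 3 * ζ ^ 2 / (64 * D ^ 2) with hκ
  have hκ0 : 0 < κ := by positivity
  have hκ1 : κ ≤ 1 := by
    rw [hκ, div_le_one (by positivity)]
    nlinarith
  have hρ : 1 - r * ζ + 4 * (r * D) ^ 2 = 1 - κ := by
    rw [hrD, hr, hκ]; field_simp; ring
  set W : ℕ → Ω → ℝ := fun t => (S t).indicator (fun ω => Real.exp (r * (Z t ω - θ))) with hW
  set G : ℕ → Ω → ℝ := fun t =>
    (S t ∩ {ω | θ ≤ Z t ω}).indicator (fun ω => Real.exp (r * (Z t ω - θ))) with hG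
  have hexpm : ∀ t, 1 ≤ t → t ≤ T → Measurable fun ω => Real.exp (r * (Z t ω - θ)) := fun t h h' =>
    Real.measurable_exp.comp (((hZm t h h').sub_const θ).const_mul r)
  have hexpb : ∀ t, 1 ≤ t → t ≤ T → ∀ ω,
      Real.exp (r * (Z t ω - θ)) ≤ Real.exp (r * (t * D - θ)) := fun t h h' ω => by
    have := hZle t h h' ω
    gcongr
  have hexpint : ∀ t, 1 ≤ t → t ≤ T → Integrable (fun ω => Real.exp (r * (Z t ω - θ))) P :=
    fun t h h' => integrable_of_nonneg_of_le (hexpm t h h') (fun ω => (Real.exp_pos _).le)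
      (hexpb t h h')
  have hWint : ∀ t, 1 ≤ t → t ≤ T → Integrable (W t) P := fun t h h' =>
    (hexpint t h h').indicator (hSm t h h')
  have hGint : ∀ t, 1 ≤ t → t ≤ T → Integrable (G t) P := fun t h h' =>
    (hexpint t h h').indicator ((hSm t h h').inter (measurableSet_le measurable_const (hZm t h h')))
  have hGW : ∀ t ω, G t ω ≤ W t ω := fun t ω =>
    Set.indicator_le_indicator_of_subset Set.inter_subset_left (fun _ => (Real.exp_pos _).le) ω
  have hG0 : ∀ t ω, 0 ≤ G t ω := fun t ω => Set.indicator_nonneg (fun _ _ => (Real.exp_pos _).le) ω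
  have hGX : ∀ t, 1 ≤ t → t < T → Integrable (fun ω => G t ω * X t ω) P := by
    intro t h h'
    refine (hGint t h h'.le).mul_bdd (c := D) (hXm t h h').aestronglyMeasurable ?_
    exact ae_of_all _ fun ω => hXD t h h' ω
  have hstep : ∀ t, 1 ≤ t → t < T → ∀ ω,
      W (t + 1) ω ≤ (1 - κ) * G t ω + r * (G t ω * X t ω) + 3 := by
    intro t h h' ω
    have hx := hXD t h h' ω
    have hfac : 0 ≤ (1 - κ) + r * X t ω := by
      have h1 : |r * X t ω| ≤ 1 / 16 := by
        rw [abs_mul, abs_of_pos hr0]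
        exact (mul_le_mul_of_nonneg_left hx hr0.le).trans hrD16
      have h2 : κ ≤ 3 / 64 := by
        rw [hκ, div_le_div_iff₀ (by positivity) (by norm_num)]
        nlinarith
      linarith [(abs_le.1 h1).1]
    have hnn : 0 ≤ (1 - κ) * G t ω + r * (G t ω * X t ω) := by
      nlinarith [mul_nonneg (hG0 t ω) hfac]
    by_cases hω : ω ∈ S (t + 1)
    · have hωt := hS t h h' hω
      rw [hW]
      simp only [Set.indicator_of_mem hω]
      by_cases hz : θ ≤ Z t ω
      · have hGe : G t ω = Real.exp (r * (Z t ω - θ)) :=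
          Set.indicator_of_mem (show ω ∈ S t ∩ {ω | θ ≤ Z t ω} from ⟨hωt, hz⟩) _
        have := exp_step_le (θ := θ) hr0.le (by linarith) hζ.le hζD hx (hdrift t h h' ω hωt hz)
        rw [hρ, ← hGe] at this
        linarith
      · have h1 : Real.exp (r * (Z (t + 1) ω - θ)) ≤ Real.exp 1 := by
          refine Real.exp_le_exp.2 ?_
          have h2 : Z (t + 1) ω - θ ≤ D := by
            push Not at hz
            linarith [hZD t h h' ω]
          nlinarith [mul_le_mul_of_nonneg_left h2 hr0.le]
        linarith [Real.exp_one_lt_d9]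
    · rw [hW]
      simp only [Set.indicator_of_notMem hω]
      linarith
  have hmean : ∀ t, 1 ≤ t → t ≤ T → ∫ ω, W t ω ∂P ≤ 64 * D ^ 2 / ζ ^ 2 + 1 := by
    intro t ht
    induction t, ht using Nat.le_induction with
    | base =>
      intro h'
      calc ∫ ω, W 1 ω ∂P ≤ ∫ _ω, (1 : ℝ) ∂P := by
            refine integral_mono (hWint 1 le_rfl h') (integrable_const _) fun ω => ?_
            refine Set.indicator_le' (fun ω _ => ?_) (fun _ _ => zero_le_one) ω
            rw [hZ1]
            refine Real.exp_le_one_iff.2 ?_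
            nlinarith
        _ = 1 := by simp
        _ ≤ _ := by
            have : 0 ≤ 64 * D ^ 2 / ζ ^ 2 := by positivity
            linarith
    | succ t ht ih =>
      intro htT
      have hlt : t < T := by omega
      have i1 := (hGint t ht hlt.le).const_mul (1 - κ)
      have i2 := (hGX t ht hlt).const_mul r
      have i12 : Integrable (fun ω => (1 - κ) * G t ω + r * (G t ω * X t ω)) P := i1.add i2
      have hGle : ∫ ω, G t ω ∂P ≤ ∫ ω, W t ω ∂P :=
        integral_mono (hGint t ht hlt.le) (hWint t ht hlt.le) (hGW t)
      have hm : ∫ ω, G t ω * X t ω ∂P = 0 := hmart t ht hlt r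
      calc ∫ ω, W (t + 1) ω ∂P
          ≤ ∫ ω, ((1 - κ) * G t ω + r * (G t ω * X t ω) + 3) ∂P :=
            integral_mono (hWint (t + 1) (by omega) htT) (i12.add (integrable_const _))
              (hstep t ht hlt)
        _ = (1 - κ) * ∫ ω, G t ω ∂P + 3 := by
            rw [integral_add i12 (integrable_const _), integral_add i1 i2, integral_const_mul,
              integral_const_mul, hm]
            simp
        _ ≤ (1 - κ) * (64 * D ^ 2 / ζ ^ 2 + 1) + 3 := by
            have := mul_le_mul_of_nonneg_left (hGle.trans (ih hlt.le))
              (sub_nonneg.2 hκ1)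
            linarith
        _ ≤ 64 * D ^ 2 / ζ ^ 2 + 1 := by
            have : κ * (64 * D ^ 2 / ζ ^ 2) = 3 := by rw [hκ]; field_simp
            nlinarith
  have hZint : Integrable (Z T) P :=
    integrable_of_nonneg_of_le (hZm T hT le_rfl) (hZ0 T hT le_rfl) (hZle T hT le_rfl)
  have hSc := (hSm T hT le_rfl).compl
  have hpath : ∀ ω, Z T ω ≤ θ + r⁻¹ * W T ω + (S T)ᶜ.indicator (fun _ => (T : ℝ) * D) ω := by
    intro ω
    by_cases hω : ω ∈ S T
    · rw [hW]
      simp only [Set.indicator_of_mem hω,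
        Set.indicator_of_notMem (show ω ∉ (S T)ᶜ from fun h => h hω)]
      have h1 := Real.add_one_le_exp (r * (Z T ω - θ))
      have h2 : Z T ω - θ ≤ r⁻¹ * Real.exp (r * (Z T ω - θ)) := by
        rw [inv_mul_eq_div, le_div_iff₀ hr0]
        linarith
      linarith
    · rw [hW]
      simp only [Set.indicator_of_notMem hω, Set.indicator_of_mem (show ω ∈ (S T)ᶜ from hω)]
      linarith [hZle T hT le_rfl ω]
  have j1 : Integrable (fun ω => θ + r⁻¹ * W T ω) P :=
    (integrable_const _).add ((hWint T hT le_rfl).const_mul _)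
  have j2 : Integrable ((S T)ᶜ.indicator (fun _ => (T : ℝ) * D)) P :=
    (integrable_const _).indicator hSc
  calc ∫ ω, Z T ω ∂P
      ≤ ∫ ω, (θ + r⁻¹ * W T ω + (S T)ᶜ.indicator (fun _ => (T : ℝ) * D) ω) ∂P :=
        integral_mono hZint (j1.add j2) hpath
    _ = θ + r⁻¹ * ∫ ω, W T ω ∂P + P.real (S T)ᶜ * (T * D) := by
        rw [integral_add j1 j2, integral_add (integrable_const _)
          ((hWint T hT le_rfl).const_mul _), integral_const_mul, integral_indicator_const _ hSc]
        simp
    _ ≤ θ + r⁻¹ * (64 * D ^ 2 / ζ ^ 2 + 1) + P.real (S T)ᶜ * (T * D) := by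
        gcongr
        exact hmean T hT le_rfl
    _ = _ := by rw [hr, inv_div]; ring

end Drift

/-! ### The backlogs of the policy -/

variable {V : Type*} [Fintype V] [DecidableEq V] {Ω : Type*} [mΩ : MeasurableSpace Ω]
  {E : Finset (V × V)} {cap : E → ℝ} {a : ℕ → V → V → Ω → ℝ}
  {P : Measure Ω} [IsProbabilityMeasure P] {ℱ : Filtration ℕ mΩ} {rate : V → V → ℝ}
  {η : ℕ → E → Ω → ℝ} {σ : NNReal} {c : E → ℝ} {β δ ν : ℝ} {T : ℕ} {π : Policy E cap a}

omit [Fintype V] [DecidableEq V] in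
/-- With probability at least `1 - O(1 / T)` the noise before slot `T` is at most
`2 * σ * √(log T)`. -/
theorem measureReal_noise_le (hM : IsModel E P ℱ a rate η σ) (hσ : 0 < σ) (hT : 1 ≤ T) :
    P.real {ω | ∀ τ < T, ∀ e, |η τ e ω| ≤ 2 * σ * √(Real.log T)}ᶜ ≤ 2 * E.card / T := by
  have hσ' : (0 : ℝ) < σ := by exact_mod_cast hσ
  have hT0 : (0 : ℝ) < T := by exact_mod_cast hT
  set x : ℝ := 2 * σ * √(Real.log T) with hx
  have hx0 : 0 ≤ x := by positivity
  have htail : ∀ τ e, P.real {ω | x ≤ |η τ e ω|} ≤ 2 * (1 / (T : ℝ) ^ 2) := by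
    intro τ e
    have hexp : Real.exp (-x ^ 2 / (2 * ((σ ^ 2 : NNReal) : ℝ))) = 1 / (T : ℝ) ^ 2 := by
      have : -x ^ 2 / (2 * ((σ ^ 2 : NNReal) : ℝ)) = -Real.log ((T : ℝ) ^ 2) := by
        rw [hx, mul_pow, Real.sq_sqrt (Real.log_nonneg (by exact_mod_cast hT)), Real.log_pow]
        push_cast
        field_simp
      rw [this, Real.exp_neg, Real.exp_log (by positivity), one_div]
    have h1 := (hM.noise_subgaussian τ e).measure_ge_le hx0
    have h2 := (hM.noise_subgaussian τ e).neg.measure_ge_le hx0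
    rw [hexp] at h1 h2
    have hsub : {ω | x ≤ |η τ e ω|} ⊆ {ω | x ≤ η τ e ω} ∪ {ω | x ≤ (-η τ e) ω} := by
      intro ω hω
      exact le_abs.1 (show x ≤ |η τ e ω| from hω)
    have := (measureReal_mono hsub (μ := P)).trans (measureReal_union_le _ _)
    linarith
  have hsub : {ω | ∀ τ < T, ∀ e, |η τ e ω| ≤ x}ᶜ
      ⊆ ⋃ τ ∈ Finset.range T, ⋃ e ∈ (Finset.univ : Finset E), {ω | x ≤ |η τ e ω|} := by
    intro ω hω
    simp only [Set.mem_compl_iff, Set.mem_ofPred_eq, not_forall, not_le] at hω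
    obtain ⟨τ, hτ, e, he⟩ := hω
    simp only [Set.mem_iUnion, Finset.mem_range, Finset.mem_univ, Set.mem_ofPred_eq]
    exact ⟨τ, hτ, e, trivial, he.le⟩
  calc _ ≤ P.real (⋃ τ ∈ Finset.range T, ⋃ e ∈ (Finset.univ : Finset E), {ω | x ≤ |η τ e ω|}) :=
        measureReal_mono hsub (measure_ne_top _ _)
    _ ≤ ∑ τ ∈ Finset.range T, ∑ _e : E, 2 * (1 / (T : ℝ) ^ 2) :=
        (measureReal_biUnion_finset_le _ _).trans (Finset.sum_le_sum fun τ _ =>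
          (measureReal_biUnion_finset_le _ _).trans (Finset.sum_le_sum fun e _ => htail τ e))
    _ = 2 * E.card / T := by
        simp
        field_simp

omit [DecidableEq V] in
theorem penalty_diff_le {m f : E → V → ℝ} (hm : m ∈ feasibleSet E cap)
    (hf : f ∈ feasibleSet E cap) {u w : E → ℝ} (huw : ∀ e, |u e| ≤ w e) :
    ∑ e, ∑ k, (m e k - f e k) * u e ≤ 2 * ∑ e, cap e * w e := by
  rw [Finset.mul_sum]
  refine Finset.sum_le_sum fun e _ => ?_
  have hnn := (abs_nonneg _).trans (huw e)
  calc ∑ k, (m e k - f e k) * u e ≤ ∑ k, (m e k + f e k) * w e := by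
        refine Finset.sum_le_sum fun k _ => ?_
        refine (le_abs_self _).trans ?_
        rw [abs_mul]
        refine mul_le_mul ?_ (huw e) (abs_nonneg _) (add_nonneg (hm.1 e k) (hf.1 e k))
        rw [abs_le]
        constructor <;> linarith [hm.1 e k, hf.1 e k]
    _ = (∑ k, m e k + ∑ k, f e k) * w e := by
        rw [← Finset.sum_mul, Finset.sum_add_distrib]
    _ ≤ (cap e + cap e) * w e := by
        have h1 := hm.2 e
        have h2 := hf.2 e
        gcongr
    _ = 2 * (cap e * w e) := by ring

/-- Backlogs, normalized to Euclidean norm one. -/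
noncomputable def Policy.direction (π : Policy E cap a) (t : ℕ) (i k : V) (ω : Ω) : ℝ :=
  π.backlog t i k ω / √(π.lyap t ω)

theorem Policy.direction_nonneg (π : Policy E cap a) {t : ℕ} (ht : 1 ≤ t) (i k : V) (ω : Ω) :
    0 ≤ π.direction t i k ω :=
  div_nonneg (π.backlog_nonneg ht i k ω) (Real.sqrt_nonneg _)

theorem Policy.direction_le_one (π : Policy E cap a) (t : ℕ) (i k : V) (ω : Ω) :
    π.direction t i k ω ≤ 1 :=
  div_le_one_of_le₀ (π.backlog_le_sqrt_lyap t i k ω) (Real.sqrt_nonneg _)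

/-- Above a level of order `ν`, the norm of the backlogs drifts downwards, up to the fluctuation
of the arrivals. -/
theorem sqrt_lyap_succ_le_of_le {ε K θ A : ℝ} {t : ℕ} {ω : Ω} (hε : 0 ≤ ε) (hν : 0 ≤ ν)
    (ht : 1 ≤ t) (ha : ∀ i k, 0 ≤ a t i k ω ∧ a t i k ω ≤ A)
    (hmax : IsMaxOn (objective c η β δ ν π t ω) (feasibleSet E cap)
      (fun e k => π.planned t e k ω))
    {m : E → V → ℝ} (hm : m ∈ feasibleSet E cap)
    (hslack : ∀ i k, i ≠ k →
      inflow E (fun e => m e k) i + rate i k + ε ≤ outflow E (fun e => m e k) i)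
    (hpen : ∑ e, ∑ k, (m e k - π.planned t e k ω) * costEstimate c η β δ π t e ω ≤ K)
    (hθ0 : 0 < θ)
    (hθ : 2 * ((Fintype.card V : ℝ) ^ 2 * (∑ e, cap e + A) ^ 2 + ν * K) ≤ ε * θ)
    (hz : θ ≤ √(π.lyap t ω)) :
    √(π.lyap (t + 1) ω) ≤ √(π.lyap t ω) - ε / 2
      + ∑ i, ∑ k, π.direction t i k ω * (a t i k ω - rate i k) := by
  have hdr := lyap_succ_le π ht ha hmax hm hslack
  have hsumQ := mul_le_mul_of_nonneg_left (π.sqrt_lyap_le_sum_backlog ht ω) hε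
  have hZpos : 0 < √(π.lyap t ω) := hθ0.trans_le hz
  have hZX : ∑ i, ∑ k, π.backlog t i k ω * (a t i k ω - rate i k) = √(π.lyap t ω) *
      ∑ i, ∑ k, π.direction t i k ω * (a t i k ω - rate i k) := by
    simp only [Finset.mul_sum, Policy.direction]
    refine Finset.sum_congr rfl fun i _ => Finset.sum_congr rfl fun k _ => ?_
    field_simp
  have hL : √(π.lyap t ω) ^ 2 = π.lyap t ω := Real.sq_sqrt (π.lyap_nonneg t ω)
  have hL' : √(π.lyap (t + 1) ω) ^ 2 = π.lyap (t + 1) ω :=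
    Real.sq_sqrt (π.lyap_nonneg (t + 1) ω)
  rw [hZX] at hdr
  have hpen' := mul_le_mul_of_nonneg_left hpen hν
  have hεz := mul_le_mul_of_nonneg_left hz hε
  generalize √(π.lyap t ω) = z at *
  generalize √(π.lyap (t + 1) ω) = z' at *
  generalize ∑ i, ∑ k, π.direction t i k ω * (a t i k ω - rate i k) = x at *
  generalize ∑ i, ∑ k, π.backlog t i k ω = q at *
  generalize ∑ e, ∑ k, (m e k - π.planned t e k ω) * costEstimate c η β δ π t e ω = p at *
  generalize (Fintype.card V : ℝ) ^ 2 * (∑ e, cap e + A) ^ 2 = B at *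
  have hsq : 2 * (z * (z' - z)) ≤ z' ^ 2 - z ^ 2 := by nlinarith [sq_nonneg (z' - z)]
  have hfin : z * (z' - z) ≤ z * (-(ε / 2) + x) := by linarith
  linarith [le_of_mul_le_mul_left hfin hZpos]

theorem integral_mul_sum_direction (hM : IsModel E P ℱ a rate η σ) {t : ℕ} (ht : 1 ≤ t) {A : ℝ}
    (hdiff : ∀ i k ω, |a t i k ω - rate i k| ≤ A) {g : Ω → ℝ} (hgm : Measurable[ℱ t] g) {C : ℝ}
    (hgb : ∀ ω, |g ω| ≤ C) (hq : ∀ i k, Measurable[ℱ t] (π.direction t i k)) :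
    ∫ ω, g ω * ∑ i, ∑ k, π.direction t i k ω * (a t i k ω - rate i k) ∂P = 0 := by
  have hint : ∀ i k, Integrable
      (fun ω => g ω * π.direction t i k ω * (a t i k ω - rate i k)) P := by
    intro i k
    refine Integrable.mul_bdd (c := A) ?_
      ((hM.measurable_arrival ht i k).sub_const _).aestronglyMeasurable
      (ae_of_all _ fun ω => hdiff i k ω)
    refine Integrable.mul_bdd (c := 1) ?_ ((hq i k).mono (ℱ.le t) le_rfl).aestronglyMeasurable
      (ae_of_all _ fun ω => ?_)
    · exact Integrable.of_bound (hgm.mono (ℱ.le t) le_rfl).aestronglyMeasurable _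
        (ae_of_all _ fun ω => hgb ω)
    · rw [Real.norm_of_nonneg (π.direction_nonneg ht i k ω)]
      exact π.direction_le_one t i k ω
  simp only [Finset.mul_sum, ← mul_assoc]
  rw [integral_finsetSum _ fun i _ => integrable_finsetSum _ fun k _ => hint i k]
  refine Finset.sum_eq_zero fun i _ => ?_
  rw [integral_finsetSum _ fun k _ => hint i k]
  exact Finset.sum_eq_zero fun k _ => hM.integral_mul_arrival_sub_rate ht i k (hgm.mul (hq i k))

set_option maxHeartbeats 800000 in
/-- The expected backlog at the horizon is `O(√T log T)`, with a constant that is independent of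
the horizon and of the run of the policy. -/
theorem exists_integral_sqrt_lyap_le (hM : IsModel E P ℱ a rate η σ) (hσ : 0 < σ)
    (hβ : 4 * (σ : ℝ) ^ 2 < β) (hstable : StrictlyStable E cap rate) (c : E → ℝ)
    (hc : ∀ e, 0 ≤ c e) :
    ∃ C, ∀ T : ℕ, 3 ≤ T → ∀ π : Policy E cap a,
      IsDPOP ℱ c η β ((T : ℝ) ^ (-(2 * (σ : ℝ) ^ 2 / β))) (√(T : ℝ)) T π →
      ∫ ω, √(π.lyap T ω) ∂P ≤ C * (√T * Real.log T) := by
  obtain ⟨ε, hε, m, hm, hslack⟩ := hstable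
  obtain ⟨A', hA'⟩ := hM.arrival_bounded
  set A := max A' 0 with hA
  have hA0 : 0 ≤ A := le_max_right _ _
  have ha : ∀ t, 1 ≤ t → ∀ ω i k, 0 ≤ a t i k ω ∧ a t i k ω ≤ A := fun t ht ω i k =>
    ⟨hM.arrival_nonneg t ht i k ω, (hA' t ht i k ω).trans (le_max_left _ _)⟩
  have hrate : ∀ i k, 0 ≤ rate i k ∧ rate i k ≤ A := fun i k => by
    refine ⟨hM.rate_nonneg i k, ?_⟩
    rw [← hM.arrival_mean 1 le_rfl i k]
    calc ∫ ω, a 1 i k ω ∂P ≤ ∫ _ω, A ∂P := integral_mono (hM.integrable_arrival le_rfl i k)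
          (integrable_const _) fun ω => (ha 1 le_rfl ω i k).2
      _ = A := by simp
  have hcap := cap_nonneg hm
  have hS0 : 0 ≤ ∑ e, cap e := Finset.sum_nonneg fun e _ => hcap e
  have hσ' : (0 : ℝ) < σ := by exact_mod_cast hσ
  set n : ℝ := (Fintype.card V : ℝ) ^ 2 with hn
  have hn0 : 0 ≤ n := by positivity
  set B : ℝ := n * (∑ e, cap e + A) ^ 2 with hB
  have hB0 : 0 ≤ B := by positivity
  set D : ℝ := n * (∑ e, cap e + A) + ε + 1 with hD
  have hD0 : 0 ≤ n * (∑ e, cap e + A) := by positivity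
  set K : ℝ := 2 * ∑ e, cap e * (c e + 2 * σ + √(2 * β)) with hK
  have hK0 : 0 ≤ K := mul_nonneg two_pos.le (Finset.sum_nonneg fun e _ =>
    mul_nonneg (hcap e) (add_nonneg (add_nonneg (hc e) (by positivity)) (Real.sqrt_nonneg _)))
  set C0 : ℝ := 16 * D ^ 2 / (ε / 2) * (64 * D ^ 2 / (ε / 2) ^ 2 + 1) with hC0
  have hC00 : 0 ≤ C0 := by positivity
  refine ⟨2 * (B + 1 + K) / ε + C0 + 2 * E.card * D, fun T hT π hπ => ?_⟩
  have hT0 : (0 : ℝ) < T := by exact_mod_cast (by omega : 0 < T)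
  have hlT : 1 ≤ Real.log T := by
    rw [Real.le_log_iff_exp_le hT0]
    have : (3 : ℝ) ≤ T := by exact_mod_cast hT
    linarith [Real.exp_one_lt_d9]
  have hsT : 1 ≤ √(T : ℝ) := Real.one_le_sqrt.2 (by exact_mod_cast (by omega : 1 ≤ T))
  set s : ℝ := √(Real.log T) with hs
  have hs1 : 1 ≤ s := Real.one_le_sqrt.2 hlT
  have hs2 : s ^ 2 = Real.log T := Real.sq_sqrt (by linarith)
  have hsl : s ≤ Real.log T := by nlinarith
  have hYs : √(2 * β * Real.log T) = √(2 * β) * s := Real.sqrt_mul (by nlinarith) _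
  set ν : ℝ := √(T : ℝ) with hν
  set δ : ℝ := (T : ℝ) ^ (-(2 * (σ : ℝ) ^ 2 / β)) with hδ
  -- `K * s` bounds the difference of the penalties while the noise is at most `2 * σ * s`; above
  -- `θ` the slack `ε` outweighs twice the drift caused by `B` and by the penalties.
  set θ : ℝ := 2 * (B + 1 + ν * (K * s)) / ε with hθ
  have hθ0 : 0 < θ := by positivity
  set S : ℕ → Set Ω := fun t => {ω | ∀ τ < t, ∀ e, |η τ e ω| ≤ 2 * σ * s} with hS
  have hSm : ∀ t, MeasurableSet[ℱ t] (S t) := by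
    intro t
    have : S t = ⋂ τ : ℕ, ⋂ _ : τ < t, ⋂ e, {ω | |η τ e ω| ≤ 2 * σ * s} := by
      ext ω; simp [hS]
    rw [this]
    refine MeasurableSet.iInter fun τ => MeasurableSet.iInter fun hτ =>
      MeasurableSet.iInter fun e => ?_
    have h1 : Measurable[ℱ t] (η τ e) := (hM.noise_adapted τ e).mono (ℱ.mono hτ) le_rfl
    exact measurableSet_le (continuous_abs.measurable.comp h1) measurable_const
  set Z : ℕ → Ω → ℝ := fun t ω => √(π.lyap t ω) with hZ
  have hZm : ∀ t, 1 ≤ t → t ≤ T → Measurable[ℱ t] (Z t) := fun t h h' =>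
    Real.continuous_sqrt.measurable.comp (Finset.measurable_fun_sum _ fun i _ =>
      Finset.measurable_fun_sum _ fun k _ => (hπ.backlog_adapted t h h' i k).pow_const 2)
  have hqm : ∀ t, 1 ≤ t → t ≤ T → ∀ i k, Measurable[ℱ t] (π.direction t i k) :=
    fun t h h' i k => (hπ.backlog_adapted t h h' i k).div (hZm t h h')
  set X : ℕ → Ω → ℝ := fun t ω =>
    ∑ i, ∑ k, π.direction t i k ω * (a t i k ω - rate i k) with hX
  have hdiff : ∀ t, 1 ≤ t → ∀ i k ω, |a t i k ω - rate i k| ≤ A := fun t ht i k ω =>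
    abs_le.2 ⟨by linarith [(ha t ht ω i k).1, (hrate i k).2],
      by linarith [(ha t ht ω i k).2, (hrate i k).1]⟩
  have hXm : ∀ t, 1 ≤ t → t < T → Measurable (X t) := fun t h h' =>
    Finset.measurable_fun_sum _ fun i _ => Finset.measurable_fun_sum _ fun k _ =>
      ((hqm t h h'.le i k).mono (ℱ.le t) le_rfl).mul ((hM.measurable_arrival h i k).sub_const _)
  have hZD : ∀ t, 1 ≤ t → t < T → ∀ ω, Z (t + 1) ω ≤ Z t ω + D := fun t h _ ω => by
    have := π.sqrt_lyap_succ_le h hA0 (ha t h ω)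
    simp only [hZ]
    linarith
  have hXD : ∀ t, 1 ≤ t → t < T → ∀ ω, |X t ω| ≤ D := fun t h _ ω => by
    calc |X t ω| ≤ ∑ _i : V, ∑ _k : V, A := by
          refine (Finset.abs_sum_le_sum_abs _ _).trans (Finset.sum_le_sum fun i _ => ?_)
          refine (Finset.abs_sum_le_sum_abs _ _).trans (Finset.sum_le_sum fun k _ => ?_)
          rw [abs_mul, abs_of_nonneg (π.direction_nonneg h i k ω)]
          calc _ ≤ 1 * A := mul_le_mul (π.direction_le_one t i k ω) (hdiff t h i k ω)
                (abs_nonneg _) zero_le_one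
            _ = A := one_mul A
      _ = n * A := by simp [hn]; ring
      _ ≤ D := by nlinarith [mul_nonneg hn0 hS0]
  have hdrift : ∀ t, 1 ≤ t → t < T → ∀ ω ∈ S t, θ ≤ Z t ω →
      Z (t + 1) ω ≤ Z t ω - ε / 2 + X t ω := fun t h h' ω hω hz => by
    have hest : ∀ e, |costEstimate c η β δ π t e ω| ≤ (c e + 2 * σ + √(2 * β)) * s := by
      intro e
      have h1 := abs_costEstimate_sub_le hσ hβ hT π c e h h'.le (fun τ hτ => hω τ hτ e)
      rw [hYs] at h1
      have h2 : c e ≤ c e * s := le_mul_of_one_le_right (hc e) hs1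
      have h3 := hc e
      rw [abs_le] at h1 ⊢
      constructor <;> linarith
    have hpen := penalty_diff_le hm (π.planned_feasible t h ω) hest
    refine sqrt_lyap_succ_le_of_le hε.le (Real.sqrt_nonneg _) h (ha t h ω)
      (hπ.isMaxOn t h h'.le ω) hm hslack hpen hθ0 ?_ hz
    have hθε : ε * θ = 2 * (B + 1 + ν * (K * s)) := by rw [hθ]; field_simp
    have hKs : 2 * ∑ e, cap e * ((c e + 2 * σ + √(2 * β)) * s) = K * s := by
      rw [hK, mul_assoc, Finset.sum_mul]
      simp only [mul_assoc]
    rw [hθε, hKs]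
    linarith
  have hZb : ∀ t, 1 ≤ t → ∀ ω, Z t ω ≤ n * (t * (∑ e, cap e + A)) := by
    intro t h ω
    refine (π.sqrt_lyap_le_sum_backlog h ω).trans ?_
    calc ∑ i, ∑ k, π.backlog t i k ω ≤ ∑ _i : V, ∑ _k : V, (t * (∑ e, cap e + A)) :=
          Finset.sum_le_sum fun i _ => Finset.sum_le_sum fun k _ =>
            π.backlog_le (fun t ht => ha t ht ω) h i k
      _ = _ := by simp [hn]; ring
  have hmart : ∀ t, 1 ≤ t → t < T → ∀ r : ℝ, ∫ ω, (S t ∩ {ω | θ ≤ Z t ω}).indicator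
      (fun ω => Real.exp (r * (Z t ω - θ))) ω * X t ω ∂P = 0 := fun t h h' r => by
    refine integral_mul_sum_direction hM h (hdiff t h)
      (C := Real.exp (|r| * (n * (t * (∑ e, cap e + A)) + θ)))
      ((Real.measurable_exp.comp (((hZm t h h'.le).sub_const θ).const_mul r)).indicator
        ((hSm t).inter (measurableSet_le measurable_const (hZm t h h'.le))))
      (fun ω => ?_) (hqm t h h'.le)
    rw [Set.indicator_apply]
    split_ifs
    · rw [Real.abs_exp]
      refine Real.exp_le_exp.2 ((le_abs_self _).trans ?_)
      rw [abs_mul]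
      refine mul_le_mul_of_nonneg_left ?_ (abs_nonneg r)
      have h0 : 0 ≤ Z t ω := Real.sqrt_nonneg _
      rw [abs_le]
      constructor <;> linarith [hZb t h ω]
    · simpa using (Real.exp_pos _).le
  have hmain := integral_le_of_drift (P := P) (T := T) (by omega) (by positivity) (by linarith)
    hθ0.le (fun t h h' => (hZm t h h').mono (ℱ.le t) le_rfl) hXm (fun t _ _ => ℱ.le t _ (hSm t))
    (fun t _ _ ω hω τ hτ e => hω τ (by omega) e) (fun t _ _ ω => Real.sqrt_nonneg _)
    (fun ω => by simp [hZ, π.lyap_one]) hZD hXD hdrift hmart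
  have hprob := measureReal_noise_le hM hσ (T := T) (by omega)
  have hTD : T * D * P.real (S T)ᶜ ≤ 2 * E.card * D := by
    calc T * D * P.real (S T)ᶜ ≤ T * D * (2 * E.card / T) := by gcongr
      _ = 2 * E.card * D := by field_simp
  have hνs : ν * s ≤ ν * Real.log T := by gcongr
  have h1 : 1 ≤ ν * Real.log T := one_le_mul_of_one_le_of_one_le hsT hlT
  have hB1 : B + 1 ≤ (B + 1) * (ν * Real.log T) := le_mul_of_one_le_right (by linarith) h1
  have hKs : ν * (K * s) ≤ K * (ν * Real.log T) := by
    rw [mul_left_comm]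
    exact mul_le_mul_of_nonneg_left hνs hK0
  have hθle : θ ≤ 2 * (B + 1 + K) / ε * (ν * Real.log T) := by
    rw [hθ, div_mul_eq_mul_div]
    exact div_le_div_of_nonneg_right (by linarith) hε.le
  have hrest : C0 + 2 * E.card * D ≤ (C0 + 2 * E.card * D) * (ν * Real.log T) :=
    le_mul_of_one_le_right (by positivity) h1
  calc ∫ ω, √(π.lyap T ω) ∂P ≤ θ + C0 + T * D * P.real (S T)ᶜ := hmain
    _ ≤ 2 * (B + 1 + K) / ε * (ν * Real.log T) + (C0 + 2 * E.card * D) * (ν * Real.log T) := by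
        linarith
    _ = _ := by ring

end

/-! ### Comparison of the policy with the static benchmark -/

section UpperBound

variable {V : Type*} [Fintype V] [DecidableEq V] {Ω : Type*} [mΩ : MeasurableSpace Ω]
  {E : Finset (V × V)} {cap : E → ℝ} {a : ℕ → V → V → Ω → ℝ}
  {rate : V → V → ℝ} {η : ℕ → E → Ω → ℝ} {c : E → ℝ} {β δ ν : ℝ} {T : ℕ} {π : Policy E cap a}

/-- The drift-plus-penalty inequality without slack, summed over the horizon. -/
theorem sum_estimated_cost_le {A : ℝ} {ω : Ω}
    (ha : ∀ t, 1 ≤ t → ∀ i k, 0 ≤ a t i k ω ∧ a t i k ω ≤ A)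
    (hmax : ∀ t, 1 ≤ t → t ≤ T → IsMaxOn (objective c η β δ ν π t ω) (feasibleSet E cap)
      (fun e k => π.planned t e k ω))
    {m : E → V → ℝ} (hm : Supports cap rate m) :
    ν * ∑ t ∈ Finset.Icc 1 T,
        ∑ e, ∑ k, (π.planned t e k ω - m e k) * costEstimate c η β δ π t e ω
      ≤ T * ((Fintype.card V : ℝ) ^ 2 * (∑ e, cap e + A) ^ 2)
        + ∑ t ∈ Finset.Icc 1 T, ∑ i, ∑ k, π.backlog t i k ω * (a t i k ω - rate i k) := by
  have key : ∀ N ≤ T, π.lyap (N + 1) ω ≤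
      2 * (N * ((Fintype.card V : ℝ) ^ 2 * (∑ e, cap e + A) ^ 2))
      + 2 * ∑ t ∈ Finset.Icc 1 N, ∑ i, ∑ k, π.backlog t i k ω * (a t i k ω - rate i k)
      - 2 * (ν * ∑ t ∈ Finset.Icc 1 N,
        ∑ e, ∑ k, (π.planned t e k ω - m e k) * costEstimate c η β δ π t e ω) := by
    intro N
    induction N with
    | zero => intro _; simp [π.lyap_one]
    | succ N ih =>
      intro hN
      have h1 := ih (by omega)
      have h2 := lyap_succ_le π (t := N + 1) (by omega) (ha (N + 1) (by omega))
        (hmax (N + 1) (by omega) hN) (ε := 0) hm.1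
        (fun i k hik => by simpa using hm.2 i k hik)
      have h3 : ∑ e, ∑ k, (m e k - π.planned (N + 1) e k ω) * costEstimate c η β δ π (N + 1) e ω
          = -∑ e, ∑ k, (π.planned (N + 1) e k ω - m e k)
            * costEstimate c η β δ π (N + 1) e ω := by
        simp only [← Finset.sum_neg_distrib]
        exact Finset.sum_congr rfl fun e _ => Finset.sum_congr rfl fun k _ => by ring
      rw [h3] at h2
      rw [Finset.sum_Icc_succ_top (by omega), Finset.sum_Icc_succ_top (by omega)]
      push_cast
      linarith
  linarith [key T le_rfl, π.lyap_nonneg (T + 1) ω]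

/-- Optimism: what the policy loses against a feasible flow through wrong cost estimates is bounded
by the confidence radii of the edges that it uses, which it then observes. -/
theorem sum_estimation_error_le {t : ℕ} (ht : 1 ≤ t) {ω : Ω} {m : E → V → ℝ}
    (hm : m ∈ feasibleSet E cap) {Y : ℝ} (hY : 0 ≤ Y) {u D : E → ℝ} (hD : ∀ e, 0 ≤ D e)
    (h1 : ∀ e, u e - c e ≤ D e)
    (h2 : ∀ e, c e - u e ≤ 2 * Y / √(obsCount π t e ω) + D e) :
    ∑ e, ∑ k, (π.planned t e k ω - m e k) * (c e - u e)
      ≤ ∑ e, cap e * (2 * Y * (observed π t e ω / √(obsCount π t e ω)) + 2 * D e) := by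
  refine Finset.sum_le_sum fun e _ => ?_
  have hf := π.planned_feasible t ht ω
  set ρ := 2 * Y * (observed π t e ω / √(obsCount π t e ω)) with hρ
  have hρ0 : 0 ≤ ρ := mul_nonneg (by positivity)
    (div_nonneg (observed_nonneg π t e ω) (Real.sqrt_nonneg _))
  calc ∑ k, (π.planned t e k ω - m e k) * (c e - u e)
      ≤ ∑ k, (π.planned t e k ω * (ρ + D e) + m e k * D e) := by
        refine Finset.sum_le_sum fun k _ => ?_
        have h3 := mul_le_mul_of_nonneg_left (h1 e) (hm.1 e k)
        have h4 := mul_le_mul_of_nonneg_left (h2 e) (hf.1 e k)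
        have h5 : π.planned t e k ω * ρ
            = π.planned t e k ω * (2 * Y / √(obsCount π t e ω)) := by
          conv_rhs => rw [← planned_mul_observed π ht e k ω]
          rw [hρ]
          ring
        simp only at h4
        linarith
    _ = (∑ k, π.planned t e k ω) * (ρ + D e) + (∑ k, m e k) * D e := by
        rw [Finset.sum_add_distrib, Finset.sum_mul, Finset.sum_mul]
    _ ≤ cap e * (ρ + D e) + cap e * D e := by
        have h3 := hf.2 e
        have h4 := hm.2 e
        have h5 := hD e
        gcongr
    _ = cap e * (ρ + 2 * D e) := by ring

variable {P : Measure Ω} [IsProbabilityMeasure P] {ℱ : Filtration ℕ mΩ} {σ : NNReal}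

/-- The expected transmission costs of the policy exceed those of a static flow by `O(√T log T)`,
with a constant that is independent of the horizon, the run of the policy and the static flow. -/
theorem exists_sum_planned_cost_le (hM : IsModel E P ℱ a rate η σ) (hσ : 0 < σ)
    (hβ : 4 * (σ : ℝ) ^ 2 < β) (hcap : ∀ e, 0 ≤ cap e) (c : E → ℝ) :
    ∃ C, ∀ T : ℕ, 3 ≤ T → ∀ π : Policy E cap a,
      IsDPOP ℱ c η β ((T : ℝ) ^ (-(2 * (σ : ℝ) ^ 2 / β))) (√(T : ℝ)) T π →
      ∀ m, Supports cap rate m →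
      ∑ t ∈ Finset.Icc 1 T, ∑ e, ∑ k, (∫ ω, π.planned t e k ω ∂P) * c e
        ≤ T * ∑ e, ∑ k, m e k * c e + C * (√T * Real.log T) := by
  obtain ⟨A, hA⟩ := hM.arrival_bounded
  set B : ℝ := (Fintype.card V : ℝ) ^ 2 * (∑ e, cap e + A) ^ 2 with hB
  have hB0 : 0 ≤ B := by positivity
  have hS0 : 0 ≤ ∑ e, cap e := Finset.sum_nonneg fun e _ => hcap e
  refine ⟨B + (∑ e, cap e) * (12 * √(2 * β) + 4 * σ), fun T hT π hπ m hm => ?_⟩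
  have hT0 : (0 : ℝ) < T := by exact_mod_cast (by omega : 0 < T)
  have hlT : 1 ≤ Real.log T := by
    rw [Real.le_log_iff_exp_le hT0]
    have : (3 : ℝ) ≤ T := by exact_mod_cast hT
    linarith [Real.exp_one_lt_d9]
  have hT1 : (1 : ℝ) ≤ T := by exact_mod_cast (by omega : 1 ≤ T)
  have hsT : 1 ≤ √(T : ℝ) := Real.one_le_sqrt.2 hT1
  have hν : 0 < √(T : ℝ) := by linarith
  set δ : ℝ := (T : ℝ) ^ (-(2 * (σ : ℝ) ^ 2 / β)) with hδ
  set Y : ℝ := √(2 * β * Real.log T) with hY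
  have hdev : ∀ t e, ∃ D : Ω → ℝ, 1 ≤ t → t ≤ T → Integrable D P ∧ ∫ ω, D ω ∂P ≤ 2 * σ / T ∧
      ∀ ω, 0 ≤ D ω ∧ costEstimate c η β δ π t e ω - c e ≤ D ω ∧
        c e - costEstimate c η β δ π t e ω ≤ 2 * Y / √(obsCount π t e ω) + D ω := by
    intro t e
    by_cases h : 1 ≤ t ∧ t ≤ T
    · obtain ⟨D, hD⟩ := exists_deviation_bound hM hσ hβ hT hπ e h.1 h.2
      exact ⟨D, fun _ _ => hD⟩
    · exact ⟨0, fun h1 h2 => absurd ⟨h1, h2⟩ h⟩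
  choose D hD using hdev
  have hpath : ∀ ω, ∑ t ∈ Finset.Icc 1 T, ∑ e, ∑ k, π.planned t e k ω * c e
      ≤ (T * ∑ e, ∑ k, m e k * c e + T * B / √T + (∑ e, cap e) * (6 * Y * √(T + 1)))
        + (1 / √(T : ℝ) * ∑ t ∈ Finset.Icc 1 T,
            ∑ i, ∑ k, π.backlog t i k ω * (a t i k ω - rate i k)
        + ∑ t ∈ Finset.Icc 1 T, ∑ e, 2 * cap e * D t e ω) := by
    intro ω
    have h1 := sum_estimated_cost_le (T := T) (π := π) (c := c) (η := η) (ω := ω)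
      (fun t h i k => ⟨hM.arrival_nonneg t h i k ω, hA t h i k ω⟩)
      (fun t h h' => hπ.isMaxOn t h h' ω) hm
    have h2 : ∀ t ∈ Finset.Icc 1 T, ∑ e, ∑ k, (π.planned t e k ω - m e k)
          * (c e - costEstimate c η β δ π t e ω)
        ≤ ∑ e, cap e * (2 * Y * (observed π t e ω / √(obsCount π t e ω)) + 2 * D t e ω) := by
      intro t ht
      obtain ⟨ht1, ht2⟩ := Finset.mem_Icc.1 ht
      exact sum_estimation_error_le ht1 hm.1 (Real.sqrt_nonneg _)
        (fun e => ((hD t e ht1 ht2).2.2 ω).1) (fun e => ((hD t e ht1 ht2).2.2 ω).2.1)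
        (fun e => ((hD t e ht1 ht2).2.2 ω).2.2)
    have h3 := Finset.sum_le_sum h2
    have h4 : ∑ t ∈ Finset.Icc 1 T, ∑ e, cap e *
          (2 * Y * (observed π t e ω / √(obsCount π t e ω)) + 2 * D t e ω)
        = ∑ e, cap e * (2 * Y * ∑ t ∈ Finset.Icc 1 T, observed π t e ω / √(obsCount π t e ω))
          + ∑ t ∈ Finset.Icc 1 T, ∑ e, 2 * cap e * D t e ω := by
      rw [Finset.sum_comm, Finset.sum_comm (s := Finset.Icc 1 T), ← Finset.sum_add_distrib]
      refine Finset.sum_congr rfl fun e _ => ?_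
      rw [Finset.mul_sum, Finset.mul_sum, ← Finset.sum_add_distrib]
      exact Finset.sum_congr rfl fun t _ => by ring
    have h5 : ∑ e, cap e * (2 * Y * ∑ t ∈ Finset.Icc 1 T,
        observed π t e ω / √(obsCount π t e ω)) ≤ (∑ e, cap e) * (6 * Y * √(T + 1)) := by
      rw [Finset.sum_mul]
      refine Finset.sum_le_sum fun e _ => mul_le_mul_of_nonneg_left ?_ (hcap e)
      have := mul_le_mul_of_nonneg_left (sum_observed_div_sqrt_le π T e ω)
        (mul_nonneg two_pos.le (Real.sqrt_nonneg (2 * β * Real.log T)))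
      linarith
    have h6 : ∑ t ∈ Finset.Icc 1 T, ∑ e, ∑ k, (π.planned t e k ω - m e k) * c e
        = ∑ t ∈ Finset.Icc 1 T, ∑ e, ∑ k, (π.planned t e k ω - m e k)
            * costEstimate c η β δ π t e ω
          + ∑ t ∈ Finset.Icc 1 T, ∑ e, ∑ k, (π.planned t e k ω - m e k)
            * (c e - costEstimate c η β δ π t e ω) := by
      simp only [← Finset.sum_add_distrib]
      exact Finset.sum_congr rfl fun t _ => Finset.sum_congr rfl fun e _ =>
        Finset.sum_congr rfl fun k _ => by ring
    have h7 : ∑ t ∈ Finset.Icc 1 T, ∑ e, ∑ k, (π.planned t e k ω - m e k) * c e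
        = ∑ t ∈ Finset.Icc 1 T, ∑ e, ∑ k, π.planned t e k ω * c e
          - T * ∑ e, ∑ k, m e k * c e := by
      simp only [sub_mul, Finset.sum_sub_distrib]
      simp
    rw [mul_comm, ← le_div_iff₀ hν] at h1
    have h8 : (T * B + ∑ t ∈ Finset.Icc 1 T,
          ∑ i, ∑ k, π.backlog t i k ω * (a t i k ω - rate i k)) / √(T : ℝ)
        = T * B / √T + 1 / √(T : ℝ) * ∑ t ∈ Finset.Icc 1 T,
          ∑ i, ∑ k, π.backlog t i k ω * (a t i k ω - rate i k) := by ring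
    rw [h8] at h1
    linarith
  have hF : ∀ t ∈ Finset.Icc 1 T, ∀ i k, Integrable
      (fun ω => π.backlog t i k ω * (a t i k ω - rate i k)) P := by
    intro t ht i k
    have ht1 := (Finset.mem_Icc.1 ht).1
    refine (π.integrable_backlog hM ht1 i k).mul_bdd (c := A + rate i k)
      ((hM.measurable_arrival ht1 i k).sub_const _).aestronglyMeasurable
      (ae_of_all _ fun ω => ?_)
    change |_| ≤ _
    rw [abs_le]
    have h1 := hM.arrival_nonneg t ht1 i k ω
    have h2 := hA t ht1 i k ω
    have h3 := hM.rate_nonneg i k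
    constructor <;> linarith
  have hFs : Integrable (fun ω => ∑ t ∈ Finset.Icc 1 T,
      ∑ i, ∑ k, π.backlog t i k ω * (a t i k ω - rate i k)) P :=
    integrable_finsetSum _ fun t ht => integrable_finsetSum _ fun i _ =>
      integrable_finsetSum _ fun k _ => hF t ht i k
  have hF0 : ∫ ω, ∑ t ∈ Finset.Icc 1 T,
      ∑ i, ∑ k, π.backlog t i k ω * (a t i k ω - rate i k) ∂P = 0 := by
    rw [integral_finsetSum _ fun t ht => integrable_finsetSum _ fun i _ =>
      integrable_finsetSum _ fun k _ => hF t ht i k]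
    refine Finset.sum_eq_zero fun t ht => ?_
    rw [integral_finsetSum _ fun i _ => integrable_finsetSum _ fun k _ => hF t ht i k]
    refine Finset.sum_eq_zero fun i _ => ?_
    rw [integral_finsetSum _ fun k _ => hF t ht i k]
    obtain ⟨ht1, ht2⟩ := Finset.mem_Icc.1 ht
    exact Finset.sum_eq_zero fun k _ =>
      hM.integral_mul_arrival_sub_rate ht1 i k (hπ.backlog_adapted t ht1 ht2 i k)
  have hDi : ∀ t ∈ Finset.Icc 1 T, ∀ e, Integrable (fun ω => 2 * cap e * D t e ω) P := by
    intro t ht e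
    obtain ⟨ht1, ht2⟩ := Finset.mem_Icc.1 ht
    exact (hD t e ht1 ht2).1.const_mul _
  have hDs : Integrable (fun ω => ∑ t ∈ Finset.Icc 1 T, ∑ e, 2 * cap e * D t e ω) P :=
    integrable_finsetSum _ fun t ht => integrable_finsetSum _ fun e _ => hDi t ht e
  have hDle : ∫ ω, ∑ t ∈ Finset.Icc 1 T, ∑ e, 2 * cap e * D t e ω ∂P
      ≤ (∑ e, cap e) * (4 * σ) := by
    rw [integral_finsetSum _ fun t ht => integrable_finsetSum _ fun e _ => hDi t ht e]
    calc _ ≤ ∑ t ∈ Finset.Icc 1 T, ∑ e, 2 * cap e * (2 * σ / T) := by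
          refine Finset.sum_le_sum fun t ht => ?_
          rw [integral_finsetSum _ fun e _ => hDi t ht e]
          obtain ⟨ht1, ht2⟩ := Finset.mem_Icc.1 ht
          refine Finset.sum_le_sum fun e _ => ?_
          rw [integral_const_mul]
          exact mul_le_mul_of_nonneg_left (hD t e ht1 ht2).2.1 (mul_nonneg two_pos.le (hcap e))
      _ = (∑ e, cap e) * (4 * σ) := by
          have h : ∑ e, 2 * cap e * (2 * σ / T) = 2 * (∑ e, cap e) * (2 * σ / T) := by
            rw [← Finset.sum_mul, ← Finset.mul_sum]
          rw [Finset.sum_const, h, Nat.card_Icc, Nat.add_sub_cancel, nsmul_eq_mul]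
          field_simp
          ring
  have hPi : ∀ t ∈ Finset.Icc 1 T, ∀ e k, Integrable (fun ω => π.planned t e k ω * c e) P :=
    fun t ht e k => (π.integrable_planned (Finset.mem_Icc.1 ht).1 e k).mul_const _
  have hPeq : ∫ ω, ∑ t ∈ Finset.Icc 1 T, ∑ e, ∑ k, π.planned t e k ω * c e ∂P
      = ∑ t ∈ Finset.Icc 1 T, ∑ e, ∑ k, (∫ ω, π.planned t e k ω ∂P) * c e := by
    rw [integral_finsetSum _ fun t ht => integrable_finsetSum _ fun e _ =>
      integrable_finsetSum _ fun k _ => hPi t ht e k]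
    refine Finset.sum_congr rfl fun t ht => ?_
    rw [integral_finsetSum _ fun e _ => integrable_finsetSum _ fun k _ => hPi t ht e k]
    refine Finset.sum_congr rfl fun e _ => ?_
    rw [integral_finsetSum _ fun k _ => hPi t ht e k]
    exact Finset.sum_congr rfl fun k _ => integral_mul_const _ _
  have hR : Integrable (fun ω => 1 / √(T : ℝ) * ∑ t ∈ Finset.Icc 1 T,
      ∑ i, ∑ k, π.backlog t i k ω * (a t i k ω - rate i k)
      + ∑ t ∈ Finset.Icc 1 T, ∑ e, 2 * cap e * D t e ω) P := (hFs.const_mul _).add hDs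
  have hmean := integral_mono (integrable_finsetSum _ fun t ht => integrable_finsetSum _ fun e _ =>
    integrable_finsetSum _ fun k _ => hPi t ht e k) ((integrable_const _).add hR) hpath
  rw [hPeq, integral_add' (integrable_const _) hR, integral_add (hFs.const_mul _) hDs,
    integral_const_mul, hF0, integral_const] at hmean
  simp only [probReal_univ, smul_eq_mul, one_mul, mul_zero, zero_add] at hmean
  have h1 : T * B / √(T : ℝ) = B * √T := by
    rw [mul_comm, mul_div_assoc, Real.div_sqrt]
  have h2 : √((T : ℝ) + 1) ≤ 2 * √T := by
    rw [Real.sqrt_le_left (by positivity), mul_pow, Real.sq_sqrt hT0.le]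
    linarith
  have h3 : Y ≤ √(2 * β) * Real.log T := by
    rw [hY, Real.sqrt_mul (by nlinarith [sq_nonneg (σ : ℝ)])]
    refine mul_le_mul_of_nonneg_left ?_ (Real.sqrt_nonneg _)
    rw [Real.sqrt_le_left (by linarith)]
    nlinarith
  have h4 : 1 ≤ √(T : ℝ) * Real.log T := one_le_mul_of_one_le_of_one_le hsT hlT
  have h5 : B * √(T : ℝ) ≤ B * (√T * Real.log T) :=
    mul_le_mul_of_nonneg_left (le_mul_of_one_le_right hν.le hlT) hB0
  have h6 : 6 * Y * √((T : ℝ) + 1) ≤ 12 * √(2 * β) * (√T * Real.log T) := by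
    calc 6 * Y * √((T : ℝ) + 1) ≤ 6 * (√(2 * β) * Real.log T) * (2 * √T) := by gcongr
      _ = _ := by ring
  have h7 : (∑ e, cap e) * (6 * Y * √((T : ℝ) + 1))
      ≤ (∑ e, cap e) * (12 * √(2 * β) * (√T * Real.log T)) :=
    mul_le_mul_of_nonneg_left h6 hS0
  have h8 : (∑ e, cap e) * (4 * σ) ≤ (∑ e, cap e) * (4 * σ) * (√T * Real.log T) :=
    le_mul_of_one_le_right (by positivity) h4
  linarith

end UpperBound

end DPOP

theorem theorem2 {V : Type*} [Fintype V] [DecidableEq V] (E : Finset (V × V))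
    (c : E → ℝ) (hc : ∀ e, 0 ≤ c e) :
    -- `C_L` depends on the network topology and the transmission costs only
    ∃ C_L : ℝ, 0 ≤ C_L ∧ ∀ cB : ℝ, C_L ≤ cB →
      ∀ (cap : E → ℝ) (rate : V → V → ℝ), DPOP.StrictlyStable E cap rate →
      ∀ {Ω : Type*} [mΩ : MeasurableSpace Ω] (P : Measure Ω) [IsProbabilityMeasure P]
        (ℱ : Filtration ℕ mΩ) (a : ℕ → V → V → Ω → ℝ) (η : ℕ → E → Ω → ℝ) (σ : NNReal),
        0 < σ → DPOP.IsModel E P ℱ a rate η σ →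
      ∀ β : ℝ, 4 * (σ : ℝ) ^ 2 < β →
      -- for every horizon `T`, a run of the policy with the parameters for this horizon
      ∀ π : ℕ → DPOP.Policy E cap a,
        (∀ T : ℕ, 1 ≤ T →
          DPOP.IsDPOP ℱ c η β ((T : ℝ) ^ (-(2 * (σ : ℝ) ^ 2 / β))) (√(T : ℝ)) T (π T)) →
      ((fun T : ℕ => DPOP.regret P c cB T (π T))
          =O[atTop] fun T : ℕ => √(T : ℝ) * Real.log (T : ℝ)) ∧
        Tendsto (fun T : ℕ => 1 / (T : ℝ) * ∑ i, ∑ k, ∫ ω, (π T).backlog T i k ω ∂P)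
          atTop (𝓝 0) := by
  obtain ⟨C_L, hCL, hlower⟩ := DPOP.exists_static_cost_le E c hc
  refine ⟨C_L, hCL, ?_⟩
  intro cB hcB cap rate hstable Ω mΩ P _ ℱ a η σ hσ hM β hβ π hπ
  have hcB0 : 0 ≤ cB := hCL.trans hcB
  have hsup : ∃ m, DPOP.Supports cap rate m := by
    obtain ⟨ε, hε, m, hm, h⟩ := hstable
    exact ⟨m, hm, fun i k hik => by linarith [h i k hik]⟩
  have hcap : ∀ e, 0 ≤ cap e := by
    obtain ⟨m, hm⟩ := hsup
    exact DPOP.cap_nonneg hm.1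
  obtain ⟨C₁, hC₁⟩ := DPOP.exists_integral_sqrt_lyap_le hM hσ hβ hstable c hc
  obtain ⟨C₂, hC₂⟩ := DPOP.exists_sum_planned_cost_le hM hσ hβ hcap c
  set n : ℝ := (Fintype.card V : ℝ) ^ 2 with hn
  have hn0 : 0 ≤ n := by positivity
  set R : ℝ := ∑ i, ∑ k, rate i k with hR
  have hR0 : 0 ≤ R :=
    Finset.sum_nonneg fun i _ => Finset.sum_nonneg fun k _ => hM.rate_nonneg i k
  have hscale : ∀ T : ℕ, 3 ≤ T → 1 ≤ √(T : ℝ) * Real.log T := by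
    intro T hT
    have h3 : (3 : ℝ) ≤ T := by exact_mod_cast hT
    have hlT : 1 ≤ Real.log T := by
      rw [Real.le_log_iff_exp_le (by linarith)]
      linarith [Real.exp_one_lt_d9]
    exact one_le_mul_of_one_le_of_one_le (Real.one_le_sqrt.2 (by linarith)) hlT
  have hQ0 : ∀ T, 1 ≤ T → 0 ≤ ∑ i, ∑ k, ∫ ω, (π T).backlog T i k ω ∂P := fun T hT =>
    Finset.sum_nonneg fun i _ => Finset.sum_nonneg fun k _ =>
      integral_nonneg fun ω => (π T).backlog_nonneg hT i k ω
  have hQ : ∀ T : ℕ, 3 ≤ T → ∑ i, ∑ k, ∫ ω, (π T).backlog T i k ω ∂P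
      ≤ n * C₁ * (√(T : ℝ) * Real.log T) := by
    intro T hT
    have hT1 : 1 ≤ T := by omega
    have hZ : Integrable (fun ω => √((π T).lyap T ω)) P := by
      refine (integrable_finsetSum Finset.univ fun i _ => integrable_finsetSum Finset.univ
        fun k _ => (π T).integrable_backlog hM hT1 i k).mono ?_ (ae_of_all _ fun ω => ?_)
      · exact (Real.continuous_sqrt.measurable.comp (Finset.measurable_fun_sum _ fun i _ =>
          Finset.measurable_fun_sum _ fun k _ =>
            ((π T).measurable_backlog T i k).pow_const 2)).aestronglyMeasurable
      · rw [Real.norm_of_nonneg (Real.sqrt_nonneg _)]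
        exact ((π T).sqrt_lyap_le_sum_backlog hT1 ω).trans (Real.le_norm_self _)
    have hle : ∑ i, ∑ k, ∫ ω, (π T).backlog T i k ω ∂P ≤ ∫ ω, n * √((π T).lyap T ω) ∂P := by
      have h1 : ∑ i, ∑ k, ∫ ω, (π T).backlog T i k ω ∂P
          = ∫ ω, ∑ i, ∑ k, (π T).backlog T i k ω ∂P := by
        rw [integral_finsetSum _ fun i _ => integrable_finsetSum _ fun k _ =>
          (π T).integrable_backlog hM hT1 i k]
        exact Finset.sum_congr rfl fun i _ => (integral_finsetSum _ fun k _ =>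
          (π T).integrable_backlog hM hT1 i k).symm
      rw [h1]
      exact integral_mono (integrable_finsetSum _ fun i _ => integrable_finsetSum _ fun k _ =>
        (π T).integrable_backlog hM hT1 i k) (hZ.const_mul n)
        fun ω => (π T).sum_backlog_le T ω
    rw [integral_const_mul] at hle
    calc _ ≤ n * ∫ ω, √((π T).lyap T ω) ∂P := hle
      _ ≤ n * (C₁ * (√(T : ℝ) * Real.log T)) :=
        mul_le_mul_of_nonneg_left (hC₁ T hT (π T) (hπ T hT1)) hn0
      _ = _ := by ring
  constructor
  · refine IsBigO.of_bound (C₂ + cB * (n * C₁) + C_L * R) ?_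
    filter_upwards [eventually_ge_atTop 3] with T hT
    have hT1 : 1 ≤ T := by omega
    have hs := hscale T hT
    rw [Real.norm_of_nonneg (by linarith : 0 ≤ √(T : ℝ) * Real.log T)]
    have hbdd : BddBelow (Set.range fun π' : DPOP.Policy E cap a =>
        ∫ ω, DPOP.totalCost c cB T π' ω ∂P) := by
      refine ⟨0, ?_⟩
      rintro _ ⟨π', rfl⟩
      exact integral_nonneg fun ω => DPOP.totalCost_nonneg π' hc hcB0 hT1 ω
    have : Nonempty (DPOP.Policy E cap a) := ⟨π T⟩
    -- the policy itself is among the competitors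
    have hreg0 : 0 ≤ DPOP.regret P c cB T (π T) := sub_nonneg.2 (ciInf_le hbdd (π T))
    rw [Real.norm_of_nonneg hreg0, DPOP.regret, sub_le_iff_le_add, ← sub_le_iff_le_add']
    refine le_ciInf fun π' => ?_
    obtain ⟨m, hm, hmle⟩ := hlower cB hcB cap rate hsup P ℱ a η σ hM π' T hT1
    have h1 := hC₂ T hT (π T) (hπ T hT1) m hm
    have h2 : ∑ t ∈ Finset.Icc 1 T, ∑ e, ∑ k, (∫ ω, (π T).actual t e k ω ∂P
        + ∫ ω, (π T).dummy t e k ω ∂P) * c e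
        ≤ ∑ t ∈ Finset.Icc 1 T, ∑ e, ∑ k, (∫ ω, (π T).planned t e k ω ∂P) * c e := by
      refine Finset.sum_le_sum fun t ht => Finset.sum_le_sum fun e _ =>
        Finset.sum_le_sum fun k _ => mul_le_mul_of_nonneg_right ?_ (hc e)
      have ht1 := (Finset.mem_Icc.1 ht).1
      rw [← integral_add ((π T).integrable_actual ht1 e k) ((π T).integrable_dummy ht1 e k)]
      exact integral_mono (((π T).integrable_actual ht1 e k).add
        ((π T).integrable_dummy ht1 e k)) ((π T).integrable_planned ht1 e k)
        fun ω => (π T).actual_add_dummy_le t ht1 e k ω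
    rw [(DPOP.integral_totalCost hM (π T) c cB hT1).2]
    have h3 := mul_le_mul_of_nonneg_left (hQ T hT) hcB0
    have h4 : C_L * R ≤ C_L * R * (√(T : ℝ) * Real.log T) :=
      le_mul_of_one_le_right (mul_nonneg hCL hR0) hs
    linarith
  · have hlim : Tendsto (fun T : ℕ => n * C₁ * (Real.log T / √(T : ℝ))) atTop (𝓝 0) := by
      have h1 : Tendsto (fun x : ℝ => Real.log x / √x) atTop (𝓝 0) := by
        simp only [Real.sqrt_eq_rpow]
        exact (isLittleO_log_rpow_atTop (by norm_num)).tendsto_div_nhds_zero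
      simpa using (h1.comp tendsto_natCast_atTop_atTop).const_mul (n * C₁)
    refine tendsto_of_tendsto_of_tendsto_of_le_of_le' tendsto_const_nhds hlim ?_ ?_
    · filter_upwards [eventually_ge_atTop 1] with T hT
      exact mul_nonneg (by positivity) (hQ0 T hT)
    · filter_upwards [eventually_ge_atTop 3] with T hT
      have hT0 : (0 : ℝ) < T := by exact_mod_cast (by omega : 0 < T)
      have hsT : 0 < √(T : ℝ) := Real.sqrt_pos.2 hT0
      calc 1 / (T : ℝ) * ∑ i, ∑ k, ∫ ω, (π T).backlog T i k ω ∂P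
          ≤ 1 / (T : ℝ) * (n * C₁ * (√(T : ℝ) * Real.log T)) :=
            mul_le_mul_of_nonneg_left (hQ T hT) (by positivity)
        _ = n * C₁ * (Real.log T / √(T : ℝ)) := by
            have : (T : ℝ) = √(T : ℝ) * √(T : ℝ) := (Real.mul_self_sqrt hT0.le).symm
            rw [this, Real.sqrt_mul_self hsT.le]
            field_simp
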